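/- Let $T$ be the regular rooted binary tree, whose vertices are the finite words over the alphabet $\{0,1\}$, and let $W=\mathrm{Aut}(T)$ be its automorphism group, with its profinite topology. For $u,v\in W$ let $(u,v)\in W$ denote the automorphism that fixes both vertices of level one and acts by $u$ and by $v$ on the two copies of $T$ below them, and let $\sigma\in W$ be the automorphism that interchanges these two copies. Write $\sim$ for conjugacy in $W$. Let $X$ be a set with a map $f\colon X\to X$, and let $C=\{p_0,q_0\}\subset X$ consist of two distinct elements with $f(p_0)\ne f(q_0)$. Assume that $P:=\bigcup_{n\ge1}f^n(C)$ is infinite, and write $p_n:=f^n(p_0)$ and $q_n:=f^n(q_0)$. For a family of elements $b_p\in W$ $(p\in P)$ let $G$ be the closure of the subgroup of $W$ that is generated by all $b_p$. The family $(b_p)$ and the group $G$ are called *weakly of type* $(X,f,C)$ if for every $p\in P$ $$b_p\sim\begin{cases}\sigma & \text{if } p=f(c) \text{ for some } c\in C\setminus P,\\ (b_c,1)\,\sigma & \text{if } p=f(c)\text{ for some } c\in C\cap P,\\ (b_q,1) & \text{if } p=f(q)\text{ for a unique } q\in P\setminus C,\\ (b_q,b_{q'}) & \text{if } p=f(q)=f(q')\text{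 for distinct } q,q'\in P\setminus C,\end{cases}$$ where, if the conditions of several lines hold for some $p$, only one of the corresponding relations is required. They are called *strongly of type* $(X,f,C)$ if, in addition, the infinite product of all $b_p$ in some order (with respect to some total order on $P$) converges to the identity element of $W$. 1. Suppose that one of the following holds: - (a) The elements $p_1,p_2,\ldots$ and $q_1,q_2,\ldots$ are all distinct. - (b) For some $r>s\ge0$ the elements $p_1,p_2,\ldots$ and $q_1,\ldots,q_r$ are all distinct, and $q_{r+1}=q_{s+1}$. - (b$'$) The same as (b) with the $p_n$ and the $q_n$ interchanged. - (c) For some $r,s\ge0$ with $r\ne s$ the elements $p_1,p_2,\ldots$ and $q_1,\ldots,q_s$ are all distinct, and $p_{r+1}=q_{s+1}$. Then every subgroup of $W$ that is weakly of type $(X,f,C)$ is equal to $W$. 2. In general, any two subgroups of $W$ that are strongly of type $(X,f,C)$ are conjugate under $W$. -/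

import Mathlib

open Filter Topology

namespace BinTree

/-- The vertices of the regular rooted binary tree `T` are the finite words over a two-letter
alphabet; the root is the empty word, the vertices of level `n` are the words of length `n`, and
the children of `u` are the two words obtained by appending one letter to `u`. -/
abbrev Vertex : Type := List Bool

/-- `IsChild u v` : there is an edge of `T` from `u` down to `v`. -/
def IsChild (u v : Vertex) : Prop := ∃ x : Bool, v = u ++ [x]

/-- `W`, the group of automorphisms of the rooted tree `T`; the product is composition. -/
def W : Type := IsChild ≃r IsChild

instance : Group W := inferInstanceAs (Group (IsChild ≃r IsChild))

instance : FunLike W Vertex Vertex := inferInstanceAs (FunLike (IsChild ≃r IsChild) Vertex Vertex)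

/-- The profinite topology of `W`, i.e. the topology of pointwise convergence on the (discrete)
set of vertices. -/
instance : TopologicalSpace W :=
  TopologicalSpace.induced (fun (g : W) (v : Vertex) => g v)
    (@Pi.topologicalSpace Vertex (fun _ => Vertex) (fun _ => ⊥))

theorem mul_apply (g h : W) (v : Vertex) : (g * h) v = g (h v) := rfl

theorem isChild_apply_iff (g : W) (u v : Vertex) : IsChild (g u) (g v) ↔ IsChild u v :=
  RelIso.map_rel_iff (show IsChild ≃r IsChild from g)

theorem inv_apply_self (g : W) (v : Vertex) : g⁻¹ (g v) = v := by
  rw [← mul_apply, inv_mul_cancel]; rfl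

theorem apply_inv_self (g : W) (v : Vertex) : g (g⁻¹ v) = v := by
  rw [← mul_apply, mul_inv_cancel]; rfl

theorem isOpen_setOf_apply_eq (v w : Vertex) : IsOpen {g : W | g v = w} := by
  let _ : TopologicalSpace Vertex := ⊥
  have : DiscreteTopology Vertex := ⟨rfl⟩
  have hc : Continuous (fun (g : W) (v : Vertex) => g v) := continuous_induced_dom
  exact (isOpen_discrete {w}).preimage ((continuous_apply v).comp hc)

theorem continuous_of_apply {Y : Type*} [TopologicalSpace Y] (F : Y → W)
    (h : ∀ v w : Vertex, IsOpen {y | F y v = w}) : Continuous F := by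
  let _ : TopologicalSpace Vertex := ⊥
  have : DiscreteTopology Vertex := ⟨rfl⟩
  refine continuous_induced_rng.2 (continuous_pi fun v => ?_)
  refine continuous_def.2 fun s _ => ?_
  have : (fun y => F y v) ⁻¹' s = ⋃ w ∈ s, {y | F y v = w} := by ext; simp
  change IsOpen ((fun y => F y v) ⁻¹' s)
  rw [this]
  exact isOpen_biUnion fun w _ => h v w

instance : IsTopologicalGroup W where
  continuous_mul := by
    refine continuous_of_apply _ fun v w => ?_
    have : {y : W × W | (y.1 * y.2) v = w} =
        ⋃ u : Vertex, {g : W | g u = w} ×ˢ {h : W | h v = u} := by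
      ext ⟨g, h⟩; simp [mul_apply]
    rw [this]
    exact isOpen_iUnion fun u =>
      (isOpen_setOf_apply_eq u w).prod (isOpen_setOf_apply_eq v u)
  continuous_inv := by
    refine continuous_of_apply _ fun v w => ?_
    have : {g : W | g⁻¹ v = w} = {g : W | g w = v} := by
      ext g
      constructor
      · rintro rfl; exact apply_inv_self g v
      · rintro rfl; exact inv_apply_self g w
    rw [this]
    exact isOpen_setOf_apply_eq w v

theorem not_isChild_nil (u : Vertex) : ¬ IsChild u [] := by
  rintro ⟨x, hx⟩; simp at hx

theorem exists_isChild {v : Vertex} (hv : v ≠ []) : ∃ u, IsChild u v :=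
  ⟨v.dropLast, v.getLast hv, (List.dropLast_append_getLast hv).symm⟩

theorem apply_nil (g : W) : g [] = [] := by
  by_contra h
  obtain ⟨u, hu⟩ := exists_isChild h
  rw [← apply_inv_self g u, isChild_apply_iff] at hu
  exact not_isChild_nil _ hu

theorem apply_eq_nil_iff (g : W) (v : Vertex) : g v = [] ↔ v = [] := by
  constructor
  · intro h
    rw [← inv_apply_self g v, h, apply_nil]
  · rintro rfl; exact apply_nil g

theorem isChild_cons_cons (x y : Bool) (u v : Vertex) :
    IsChild (x :: u) (y :: v) ↔ y = x ∧ IsChild u v := by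
  simp [IsChild]

theorem isChild_nil_cons (y : Bool) (v : Vertex) : IsChild [] (y :: v) ↔ v = [] := by
  simp [IsChild]

/-- The element `(u, v)` of `W`: it fixes both vertices of level one and acts by `u` on the copy of
`T` below the first of them and by `v` on the copy of `T` below the second. -/
def pair (u v : W) : W :=
  show IsChild ≃r IsChild from
  { toFun := fun
      | [] => []
      | false :: w => false :: u w
      | true :: w => true :: v w
    invFun := fun
      | [] => []
      | false :: w => false :: u⁻¹ w
      | true :: w => true :: v⁻¹ w
    left_inv := by
      rintro (_ | ⟨_ | _, w⟩) <;> simp [inv_apply_self]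
    right_inv := by
      rintro (_ | ⟨_ | _, w⟩) <;> simp [apply_inv_self]
    map_rel_iff' := by
      rintro (_ | ⟨_ | _, a⟩) (_ | ⟨_ | _, b⟩) <;>
        simp [not_isChild_nil, isChild_cons_cons, isChild_nil_cons, isChild_apply_iff,
          apply_eq_nil_iff] }

/-- The element `σ` of `W` which interchanges the two copies of `T` below the vertices of level
one. -/
def sigma : W :=
  show IsChild ≃r IsChild from
  { toFun := fun
      | [] => []
      | x :: w => (!x) :: w
    invFun := fun
      | [] => []
      | x :: w => (!x) :: w
    left_inv := by
      rintro (_ | ⟨x, w⟩) <;> simp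
    right_inv := by
      rintro (_ | ⟨x, w⟩) <;> simp
    map_rel_iff' := by
      rintro (_ | ⟨x, a⟩) (_ | ⟨y, b⟩) <;>
        simp [not_isChild_nil, isChild_cons_cons, isChild_nil_cons] }

/-! ### Groups attached to `(X, f, C)` -/

/-- The strictly postcritical orbit `P = ⋃_{n ≥ 1} fⁿ(C)`. -/
def postcriticalOrbit {X : Type*} (f : X → X) (C : Set X) : Set X :=
  ⋃ n : ℕ, ⋃ _ : 1 ≤ n, f^[n] '' C

/-- The family `b_p`, `p ∈ P`, is weakly of type `(X, f, C)`. The four alternatives are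
`b_p ∼ σ` if `p = f(c)` with `c ∈ C \ P`;
`b_p ∼ (b_c, 1) σ` if `p = f(c)` with `c ∈ C ∩ P`;
`b_p ∼ (b_q, 1)` if `p = f(q)` for a unique `q ∈ P \ C`;
`b_p ∼ (b_q, b_q')` if `p = f(q) = f(q')` for distinct `q, q' ∈ P \ C`.
Here `∼` is conjugacy in `W`. If, for some `p`, the conditions of several alternatives are
fulfilled, only one of the corresponding relations is required. -/
def WeaklyOfType {X : Type*} (f : X → X) (C : Set X) (b : postcriticalOrbit f C → W) : Prop :=
  ∀ p : postcriticalOrbit f C,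
    (∃ c : X, c ∈ C ∧ c ∉ postcriticalOrbit f C ∧ f c = p ∧ IsConj (b p) sigma) ∨
    (∃ c : postcriticalOrbit f C, (c : X) ∈ C ∧ f c = p ∧
      IsConj (b p) (pair (b c) 1 * sigma)) ∨
    (∃ q : postcriticalOrbit f C, (q : X) ∉ C ∧ f q = p ∧
      (∀ q' : postcriticalOrbit f C, (q' : X) ∉ C → f q' = p → q' = q) ∧
      IsConj (b p) (pair (b q) 1)) ∨
    (∃ q q' : postcriticalOrbit f C, q ≠ q' ∧ (q : X) ∉ C ∧ (q' : X) ∉ C ∧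
      f q = p ∧ f q' = p ∧ IsConj (b p) (pair (b q) (b q')))

/-- The product of the family `b` in some order converges to `1`: for some linear order on the
index set, the products over finite subsets, taken in increasing order, converge to `1` as the
finite subset grows. (In `W`, whose open normal subgroups form a neighbourhood basis of `1`,
for an order of type `ω` this is the usual convergence of the partial products.) -/
def ProductConvergesToOne {I : Type*} (b : I → W) : Prop :=
  ∃ _ : LinearOrder I,
    Tendsto (fun s : Finset I => ((s.sort (· ≤ ·)).map b).prod) atTop (𝓝 1)

/-- The family `b_p`, `p ∈ P`, is strongly of type `(X, f, C)`. -/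
def StronglyOfType {X : Type*} (f : X → X) (C : Set X) (b : postcriticalOrbit f C → W) : Prop :=
  WeaklyOfType f C b ∧ ProductConvergesToOne b

/-- The closure of the subgroup of `W` generated by the family `b`. -/
def closedSubgroupGeneratedBy {I : Type*} (b : I → W) : Subgroup W :=
  (Subgroup.closure (Set.range b)).topologicalClosure

/-- The subgroup `G` of `W` is weakly of type `(X, f, C)`. -/
def GroupWeaklyOfType {X : Type*} (f : X → X) (C : Set X) (G : Subgroup W) : Prop :=
  ∃ b : postcriticalOrbit f C → W, WeaklyOfType f C b ∧ G = closedSubgroupGeneratedBy b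

/-- The subgroup `G` of `W` is strongly of type `(X, f, C)`. -/
def GroupStronglyOfType {X : Type*} (f : X → X) (C : Set X) (G : Subgroup W) : Prop :=
  ∃ b : postcriticalOrbit f C → W, StronglyOfType f C b ∧ G = closedSubgroupGeneratedBy b

/-! ### The combinatorial cases -/

/-- The elements `fⁿ(p₀)` for `n ∈ I` and `fⁿ(q₀)` for `n ∈ J` are all distinct. -/
def AllDistinct {X : Type*} (f : X → X) (p₀ q₀ : X) (I J : Set ℕ) : Prop :=
  Set.InjOn (fun n => f^[n] p₀) I ∧ Set.InjOn (fun n => f^[n] q₀) J ∧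
    ∀ m ∈ I, ∀ n ∈ J, f^[m] p₀ ≠ f^[n] q₀

/-- Case (a): `p₁, p₂, …` and `q₁, q₂, …` are all distinct. -/
def CaseA {X : Type*} (f : X → X) (p₀ q₀ : X) : Prop :=
  AllDistinct f p₀ q₀ (Set.Ici 1) (Set.Ici 1)

/-- Case (b) with indices `r > s ≥ 0`: `p₁, p₂, …` and `q₁, …, q_r` are all distinct, and
`q_{r+1} = q_{s+1}`. Interchanging `p₀` and `q₀` gives case (b'). -/
def CaseB {X : Type*} (f : X → X) (p₀ q₀ : X) (r s : ℕ) : Prop :=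
  s < r ∧ AllDistinct f p₀ q₀ (Set.Ici 1) (Set.Icc 1 r) ∧ f^[r + 1] q₀ = f^[s + 1] q₀

/-- Case (c) with indices `r, s ≥ 0`, not both `0`: `p₁, p₂, …` and `q₁, …, q_s` are all distinct,
and `p_{r+1} = q_{s+1}`. -/
def CaseC {X : Type*} (f : X → X) (p₀ q₀ : X) (r s : ℕ) : Prop :=
  ¬ (r = 0 ∧ s = 0) ∧ AllDistinct f p₀ q₀ (Set.Ici 1) (Set.Icc 1 s) ∧
    f^[r + 1] p₀ = f^[s + 1] q₀

end BinTree

namespace BinTree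

/-! ### Sections of tree automorphisms -/

/-! Closed subgroups are recognised by a triangular test. Inside the pro-2 group `levelGroup r`, a
proper closed subgroup is killed by a nontrivial homomorphism to a finite abelian group that is
trivial on some `stab n`. Every such homomorphism is a combination of the characters `chi r k`,
which are dual to the elements `model r k`. So a closed subgroup is everything once, for each `k ≥
1`, it has an element on which `chi r k` is the first nonzero character
(`eq_levelGroup_of_leading`). For `r = 0` the group is `W` and the characters are the level signs.

Weak families: signs are class functions, so the relations determine power series over the field
with two elements: `σ` has series 1, and `(u, v)` has `X` times the sum of the series of `u` and
`v`. If an infinite orbit is disjoint from the other one, its generators have series 1, X, X², ....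
If the orbits merge after `r` and `s` steps with `s < r`, the generators before the merger give the
powers below `r`, and those after it give the multiples `X ^ i * γ`, where `γ` is `X ^ s`, `X ^ r`
or their sum. Either way all powers of `X` occur, and the group is `W`.

The remaining case is `r = s ≥ 1`. There the sum cancels, and the generators are only known to be
conjugate, one at a time, to the elements `model r k`, twice for `k ≤ r` and once for `k > r`. The
product relation makes this simultaneous: reading it on the two subtrees and eliminating the unknown
section of the second swapping generator gives a product relation of the same kind one level lower
(`exists_conj_mem_constrained`). Induction on levels and compactness of `W` conjugate the whole
family into `levelGroup r`, where the triangular test shows that it generates. Since `levelGroup r`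
depends only on `r`, any two strong groups are conjugate. `cases_of_infinite` shows that there are
no other cases. -/

theorem W.ext {g h : W} (H : ∀ v, g v = h v) : g = h :=
  DFunLike.coe_injective (F := IsChild ≃r IsChild) (funext H)

theorem apply_injective (g : W) : Function.Injective g := fun u v h => by
  rw [← inv_apply_self g u, h, inv_apply_self]

theorem exists_apply_append (g : W) (u : Vertex) (x : Bool) : ∃ y, g (u ++ [x]) = g u ++ [y] :=
  (isChild_apply_iff g u (u ++ [x])).2 ⟨x, rfl⟩

theorem length_apply (g : W) (v : Vertex) : (g v).length = v.length := by
  induction v using List.reverseRecOn with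
  | nil => rw [apply_nil]
  | append_singleton u x ih =>
    obtain ⟨y, hy⟩ := exists_apply_append g u x
    simp [hy, ih]

/-- Whether `g` interchanges the two vertices of level one. -/
def swaps (g : W) : Bool := decide (g [false] = [true])

theorem apply_singleton (g : W) (x : Bool) : g [x] = [xor x (swaps g)] := by
  have key : ∀ x, ∃ y, g [x] = [y] := fun x => by
    obtain ⟨y, hy⟩ := exists_apply_append g [] x
    exact ⟨y, by simpa [apply_nil] using hy⟩
  obtain ⟨y, hy⟩ := key false
  obtain ⟨z, hz⟩ := key true
  have hyz : y ≠ z := fun h => by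
    have := apply_injective g (hy.trans ((congrArg (fun a => [a]) h).trans hz.symm))
    simp at this
  cases x <;> cases y <;> cases z <;> simp_all [swaps]

theorem exists_apply_cons (g : W) (x : Bool) (w : Vertex) :
    ∃ t, g (x :: w) = (xor x (swaps g)) :: t := by
  induction w using List.reverseRecOn with
  | nil => exact ⟨[], apply_singleton g x⟩
  | append_singleton u z ih =>
    obtain ⟨t, ht⟩ := ih
    obtain ⟨y, hy⟩ := exists_apply_append g (x :: u) z
    exact ⟨t ++ [y], by simpa [ht] using hy⟩

theorem apply_cons_eq_cons_tail (g : W) (x : Bool) (w : Vertex) :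
    g (x :: w) = (xor x (swaps g)) :: (g (x :: w)).tail := by
  obtain ⟨t, ht⟩ := exists_apply_cons g x w
  simp [ht]

theorem swaps_inv (g : W) : swaps g⁻¹ = swaps g := by
  have h := inv_apply_self g [false]
  rw [apply_singleton, apply_singleton] at h
  cases h1 : swaps g <;> cases h2 : swaps g⁻¹ <;> simp_all

/-- The section of `g` at the vertex `x` of level one: the action of `g` on the subtree below `x`,
where the subtrees below `x` and below its image are identified with `T`. -/
def sec (g : W) (x : Bool) : W :=
  show IsChild ≃r IsChild from
  { toFun := fun w => (g (x :: w)).tail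
    invFun := fun w => (g⁻¹ ((xor x (swaps g)) :: w)).tail
    left_inv := fun w => by
      change (g⁻¹ ((xor x (swaps g)) :: (g (x :: w)).tail)).tail = w
      rw [← apply_cons_eq_cons_tail, inv_apply_self]; rfl
    right_inv := fun w => by
      change (g (x :: (g⁻¹ ((xor x (swaps g)) :: w)).tail)).tail = w
      have h := apply_cons_eq_cons_tail g⁻¹ (xor x (swaps g)) w
      rw [swaps_inv, Bool.xor_assoc, Bool.xor_self, Bool.xor_false] at h
      rw [← h, apply_inv_self]; rfl
    map_rel_iff' := by
      intro a b
      change IsChild (g (x :: a)).tail (g (x :: b)).tail ↔ IsChild a b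
      have h := isChild_apply_iff g (x :: a) (x :: b)
      rw [apply_cons_eq_cons_tail g x a, apply_cons_eq_cons_tail g x b] at h
      simpa [isChild_cons_cons] using h }

theorem apply_cons (g : W) (x : Bool) (w : Vertex) :
    g (x :: w) = (xor x (swaps g)) :: sec g x w :=
  apply_cons_eq_cons_tail g x w

theorem ext_sec {g h : W} (hs : swaps g = swaps h) (H : ∀ x, sec g x = sec h x) : g = h :=
  W.ext fun v => by
    cases v with
    | nil => rw [apply_nil, apply_nil]
    | cons x w => rw [apply_cons, apply_cons, hs, H]

theorem swaps_mul (g h : W) : swaps (g * h) = xor (swaps g) (swaps h) := by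
  have H := mul_apply g h [false]
  rw [apply_singleton, apply_singleton, apply_singleton] at H
  cases h1 : swaps g <;> cases h2 : swaps h <;> simp_all

@[simp] theorem swaps_one : swaps 1 = false := rfl

theorem sec_mul (g h : W) (x : Bool) :
    sec (g * h) x = sec g (xor x (swaps h)) * sec h x :=
  W.ext fun v => by
    have H := mul_apply g h (x :: v)
    rw [apply_cons, apply_cons, apply_cons] at H
    exact (List.cons.inj H).2

@[simp] theorem sec_one (x : Bool) : sec 1 x = 1 := rfl

theorem sec_inv (g : W) (x : Bool) : sec g⁻¹ x = (sec g (xor x (swaps g)))⁻¹ := by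
  have h := sec_mul g⁻¹ g (xor x (swaps g))
  rw [inv_mul_cancel, sec_one, Bool.xor_assoc, Bool.xor_self, Bool.xor_false] at h
  exact eq_inv_of_mul_eq_one_left h.symm

@[simp] theorem swaps_pair (u v : W) : swaps (pair u v) = false := by
  have : pair u v [false] = [false] := by
    change false :: u [] = _
    rw [apply_nil]
  simp [swaps, this]

@[simp] theorem swaps_sigma : swaps sigma = true := rfl

@[simp] theorem sec_pair_false (u v : W) : sec (pair u v) false = u := rfl

@[simp] theorem sec_pair_true (u v : W) : sec (pair u v) true = v := rfl

@[simp] theorem sec_sigma (x : Bool) : sec sigma x = 1 := rfl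

theorem eq_pair {g : W} (h : swaps g = false) : g = pair (sec g false) (sec g true) :=
  ext_sec (by simp [h]) (by rintro (_ | _) <;> simp)

theorem pair_mul (u v u' v' : W) : pair u v * pair u' v' = pair (u * u') (v * v') :=
  ext_sec (by simp [swaps_mul]) (by rintro (_ | _) <;> simp [sec_mul])

@[simp] theorem pair_one_one : pair 1 1 = 1 :=
  ext_sec (by simp) (by rintro (_ | _) <;> simp)

theorem pair_inv (u v : W) : (pair u v)⁻¹ = pair u⁻¹ v⁻¹ :=
  inv_eq_of_mul_eq_one_right (by simp [pair_mul])

@[simp] theorem sigma_mul_sigma : sigma * sigma = 1 :=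
  ext_sec (by simp [swaps_mul]) (by rintro (_ | _) <;> simp [sec_mul])

@[simp] theorem sigma_inv : sigma⁻¹ = sigma :=
  inv_eq_of_mul_eq_one_right sigma_mul_sigma

theorem sigma_mul_pair_mul_sigma (u v : W) : sigma * pair u v * sigma = pair v u :=
  ext_sec (by simp [swaps_mul]) (by rintro (_ | _) <;> simp [sec_mul])

/-! ### The level stabilizers -/

/-- The pointwise stabilizer of the first `n` levels of the tree. -/
def stab (n : ℕ) : Subgroup W where
  carrier := {g | ∀ v : Vertex, v.length ≤ n → g v = v}
  mul_mem' {g h} hg hh v hv := by rw [mul_apply, hh v hv, hg v hv]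
  one_mem' _ _ := rfl
  inv_mem' {g} hg v hv := by
    conv_lhs => rw [← hg v hv]
    exact inv_apply_self g v

theorem mem_stab {n : ℕ} {g : W} : g ∈ stab n ↔ ∀ v : Vertex, v.length ≤ n → g v = v := Iff.rfl

instance (n : ℕ) : (stab n).Normal where
  conj_mem g hg h v hv := by
    rw [mul_apply, mul_apply, hg _ (by rwa [length_apply]), apply_inv_self]

@[simp] theorem stab_zero : stab 0 = ⊤ := by
  refine eq_top_iff.2 fun g _ v hv => ?_
  rw [List.length_eq_zero_iff.1 (Nat.le_zero.1 hv), apply_nil]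

theorem mem_stab_succ {n : ℕ} {g : W} :
    g ∈ stab (n + 1) ↔ swaps g = false ∧ ∀ x, sec g x ∈ stab n := by
  constructor
  · intro h
    have hs : swaps g = false := by
      have := h [false] (by simp)
      rw [apply_singleton] at this
      simpa using this
    refine ⟨hs, fun x v hv => ?_⟩
    have := h (x :: v) (by simpa using hv)
    rw [apply_cons] at this
    exact (List.cons.inj this).2
  · rintro ⟨hs, h⟩ (_ | ⟨x, v⟩) hv
    · exact apply_nil g
    · rw [apply_cons, hs, h x v (by simpa using hv), Bool.xor_false]

theorem stab_anti {m n : ℕ} (h : m ≤ n) : stab n ≤ stab m :=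
  fun _ hg v hv => hg v (hv.trans h)

theorem finite_level (n : ℕ) : {v : Vertex | v.length ≤ n}.Finite := List.finite_length_le Bool n

theorem isOpen_stab (n : ℕ) : IsOpen (stab n : Set W) := by
  have : (stab n : Set W) = ⋂ v ∈ {v : Vertex | v.length ≤ n}, {g : W | g v = v} := by
    ext g; simp [mem_stab]
  rw [this]
  exact (finite_level n).isOpen_biInter fun v _ => isOpen_setOf_apply_eq v v

/-- A basic neighbourhood of `g` constrains finitely many vertices, so it contains the coset of `g`
modulo `stab n`, where `n` bounds their lengths. -/
theorem mem_topologicalClosure_of_forall {H : Subgroup W} {g : W}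
    (h : ∀ n, ∃ k ∈ H, k⁻¹ * g ∈ stab n) : g ∈ H.topologicalClosure := by
  let _ : TopologicalSpace Vertex := ⊥
  change g ∈ closure (H : Set W)
  rw [mem_closure_iff]
  intro U hU hgU
  obtain ⟨V, hV, rfl⟩ := isOpen_induced_iff.1 hU
  obtain ⟨I, u, hu, hI⟩ := isOpen_pi_iff.1 hV _ hgU
  obtain ⟨k, hk, hkg⟩ := h (I.sup List.length)
  refine ⟨k, hI fun v hv => ?_, hk⟩
  have := hkg v (Finset.le_sup (f := List.length) hv)
  rw [mul_apply] at this
  have e : k v = g v := by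
    conv_lhs => rw [← this]
    exact apply_inv_self k _
  change k v ∈ u v
  rw [e]
  exact (hu v hv).2

/-- A square does not swap the two subtrees, so induction applies to its sections. Hence every
quotient by `stab n` is a 2-group. -/
theorem pow_two_pow_mem_stab (n : ℕ) (g : W) : g ^ 2 ^ n ∈ stab n := by
  induction n generalizing g with
  | zero => simp
  | succ n ih =>
    have hs : swaps (g ^ 2) = false := by simp [pow_two, swaps_mul]
    have key : ∀ (u v : W) (k : ℕ), pair u v ^ k = pair (u ^ k) (v ^ k) := fun u v k => by
      induction k with
      | zero => simp
      | succ k ih => rw [pow_succ, ih, pair_mul, pow_succ, pow_succ]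
    rw [pow_succ', pow_mul, eq_pair hs, key, mem_stab_succ]
    exact ⟨by simp, by rintro (_ | _) <;> simpa using ih _⟩

/-! ### Compactness of `W` -/

theorem isEmbedding_coe :
    @IsEmbedding W (Vertex → Vertex) _ (@Pi.topologicalSpace Vertex (fun _ => Vertex) (fun _ => ⊥))
      (fun g v => g v) :=
  let _ : TopologicalSpace Vertex := ⊥
  ⟨⟨rfl⟩, fun _ _ h => W.ext (congrFun h)⟩

/-- Surjectivity is automatic because each level is finite. The remaining conditions involve at most
two vertices at a time, hence are closed; this exhibits `W` as a closed subset of a product of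
finite sets. -/
theorem exists_coe_eq {g : Vertex → Vertex} (hl : ∀ v, (g v).length = v.length)
    (hi : ∀ u v, g u = g v → u = v) (hc : ∀ u v, IsChild u v → IsChild (g u) (g v)) :
    ∃ w : W, (fun v => w v) = g := by
  have hsurj : Function.Surjective g := by
    intro v
    have hm : Set.MapsTo g {u | u.length = v.length} {u | u.length = v.length} :=
      fun u hu => (hl u).trans hu
    have hfin : {u : Vertex | u.length = v.length}.Finite :=
      (finite_level v.length).subset fun u hu => le_of_eq hu
    have := hfin.to_subtype
    have hinj : Function.Injective hm.restrict :=
      fun a b h => Subtype.ext (hi _ _ (congrArg Subtype.val h))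
    obtain ⟨u, hu⟩ := Finite.surjective_of_injective hinj ⟨v, rfl⟩
    exact ⟨u, congrArg Subtype.val hu⟩
  have hchild : ∀ u v, IsChild (g u) (g v) ↔ IsChild u v := by
    refine fun u v => ⟨fun h => ?_, hc u v⟩
    have hv : v ≠ [] := by
      rintro rfl
      have := hl []
      rw [List.length_nil, List.length_eq_zero_iff] at this
      rw [this] at h
      exact not_isChild_nil _ h
    obtain ⟨u', hu'⟩ := exists_isChild hv
    have : g u = g u' := by
      obtain ⟨x, hx⟩ := h
      obtain ⟨y, hy⟩ := hc _ _ hu'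
      exact (List.append_inj (hx.symm.trans hy) (by
        have := congrArg List.length (hx.symm.trans hy)
        simpa using this)).1
    rwa [hi _ _ this]
  exact ⟨show IsChild ≃r IsChild from
    ⟨Equiv.ofBijective g ⟨fun u v => hi u v, hsurj⟩, fun {a b} => hchild a b⟩, rfl⟩

instance : CompactSpace W := by
  let _ : TopologicalSpace Vertex := ⊥
  have : DiscreteTopology Vertex := ⟨rfl⟩
  have hr : Set.range (fun (g : W) (v : Vertex) => g v) =
      {g | ∀ v, (g v).length = v.length} ∩ {g | ∀ u v, g u = g v → u = v} ∩
        {g | ∀ u v, IsChild u v → IsChild (g u) (g v)} := by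
    ext g
    constructor
    · rintro ⟨w, rfl⟩
      exact ⟨⟨length_apply w, fun u v h => apply_injective w h⟩,
        fun u v h => (isChild_apply_iff w u v).2 h⟩
    · rintro ⟨⟨hl, hi⟩, hc⟩
      exact exists_coe_eq hl hi hc
  have hclosed : ∀ (u v : Vertex) (p : Vertex → Vertex → Prop),
      IsClosed {g : Vertex → Vertex | p (g u) (g v)} := fun u v p =>
    IsClosed.preimage (f := fun g : Vertex → Vertex => (g u, g v))
      ((continuous_apply u).prodMk (continuous_apply v)) (isClosed_discrete {q : Vertex × Vertex | p q.1 q.2})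
  have hcompact : IsCompact (Set.range (fun (g : W) (v : Vertex) => g v)) := by
    refine IsCompact.of_isClosed_subset
      (isCompact_univ_pi fun v : Vertex => ((finite_level v.length).isCompact)) ?_ ?_
    · rw [hr]
      simp only [Set.ofPred_forall]
      refine ((isClosed_iInter fun v => hclosed v v fun a _ => a.length = v.length).inter
        (isClosed_iInter fun u => isClosed_iInter fun v => hclosed u v fun a b => a = b → u = v)).inter
        (isClosed_iInter fun u => isClosed_iInter fun v => isClosed_iInter fun _ =>
          hclosed u v IsChild)
    · rintro _ ⟨g, rfl⟩ v -
      exact (length_apply g v).le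
  rw [← isCompact_univ_iff, isEmbedding_coe.isCompact_iff, Set.image_univ]
  exact hcompact

/-! ### Signs -/

/-- The root activity of `g`, as an element of `ZMod 2`. -/
def act (g : W) : ZMod 2 := if swaps g then 1 else 0

theorem act_mul (g h : W) : act (g * h) = act g + act h := by
  unfold act
  rw [swaps_mul]
  cases swaps g <;> cases swaps h <;> rfl

theorem act_eq_zero_iff {g : W} : act g = 0 ↔ swaps g = false := by
  unfold act
  cases swaps g <;> simp

theorem zmod_two_eq_one_of_ne_zero : ∀ {a : ZMod 2}, a ≠ 0 → a = 1 := by decide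

theorem act_eq_one_iff {g : W} : act g = 1 ↔ swaps g = true := by
  unfold act
  cases swaps g <;> simp

/-- The sum of `F (sec g x)` over the two vertices `x` of level one is additive in `g`, if `F` is. -/
theorem sum_sec_mul {F : W → ZMod 2} (g h : W)
    (hF : ∀ x y, F (sec g x * sec h y) = F (sec g x) + F (sec h y)) :
    F (sec (g * h) false) + F (sec (g * h) true) =
      (F (sec g false) + F (sec g true)) + (F (sec h false) + F (sec h true)) := by
  rw [sec_mul, sec_mul, hF, hF]
  cases swaps h <;> simp only [Bool.xor_false, Bool.xor_true, Bool.not_true, Bool.not_false] <;> ring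

/-- The sign of the permutation which `g` induces on the vertices of level `n`, written additively
and with the sign of the permutation at level `n - 1` of each subtree added up: `sgn 1` is the root
activity, and `sgn (n + 2) g` is the sum of `sgn (n + 1)` over the two sections of `g`.
By convention `sgn 0` is trivial. -/
def sgn : ℕ → W → ZMod 2
  | 0, _ => 0
  | 1, g => act g
  | n + 2, g => sgn (n + 1) (sec g false) + sgn (n + 1) (sec g true)

@[simp] theorem sgn_zero (g : W) : sgn 0 g = 0 := rfl

theorem sgn_one_left (g : W) : sgn 1 g = act g := rfl

theorem sgn_succ_succ (n : ℕ) (g : W) :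
    sgn (n + 2) g = sgn (n + 1) (sec g false) + sgn (n + 1) (sec g true) := rfl

theorem sgn_succ {n : ℕ} (hn : n ≠ 0) (g : W) :
    sgn (n + 1) g = sgn n (sec g false) + sgn n (sec g true) := by
  obtain ⟨n, rfl⟩ := Nat.exists_eq_succ_of_ne_zero hn
  rfl

theorem sgn_mul (n : ℕ) (g h : W) : sgn n (g * h) = sgn n g + sgn n h := by
  induction n generalizing g h with
  | zero => simp
  | succ n ih =>
    cases n with
    | zero => exact act_mul g h
    | succ n => exact sum_sec_mul g h fun x y => ih _ _

@[simp] theorem sgn_one (n : ℕ) : sgn n 1 = 0 := by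
  have := sgn_mul n 1 1
  simpa using this

@[simp] theorem sgn_inv (n : ℕ) (g : W) : sgn n g⁻¹ = sgn n g := by
  have h := sgn_mul n g⁻¹ g
  rw [inv_mul_cancel, sgn_one, eq_comm, CharTwo.add_eq_zero] at h
  exact h

theorem sgn_conj (n : ℕ) (w g : W) : sgn n (w * g * w⁻¹) = sgn n g := by
  rw [sgn_mul, sgn_mul, sgn_inv, add_right_comm, CharTwo.add_self_eq_zero, zero_add]

theorem sgn_eq_of_isConj (n : ℕ) {g h : W} (H : IsConj g h) : sgn n g = sgn n h := by
  obtain ⟨c, rfl⟩ := isConj_iff.1 H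
  exact (sgn_conj n c g).symm

theorem sgn_eq_zero_of_mem_stab {n j : ℕ} (h : j ≤ n) {g : W} (hg : g ∈ stab n) : sgn j g = 0 := by
  induction n generalizing j g with
  | zero => simp [Nat.le_zero.1 h]
  | succ n ih =>
    obtain ⟨hs, hsec⟩ := mem_stab_succ.1 hg
    rcases j with _ | _ | j
    · rfl
    · exact act_eq_zero_iff.2 hs
    · rw [sgn_succ_succ, ih (by omega) (hsec _), ih (by omega) (hsec _), add_zero]

/-! ### The constrained groups -/

/-- The elements `g` for which, at each vertex of level less than `n`, the two sections
below that vertex have the same sign of index `r`. -/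
def constrained (r : ℕ) : ℕ → Subgroup W
  | 0 => ⊤
  | n + 1 =>
    { carrier := {g | sgn r (sec g false) = sgn r (sec g true) ∧ ∀ x, sec g x ∈ constrained r n}
      one_mem' := ⟨rfl, fun x => one_mem _⟩
      mul_mem' := by
        rintro g h ⟨hg, hg'⟩ ⟨hh, hh'⟩
        refine ⟨?_, fun x => ?_⟩
        · rw [sec_mul, sec_mul, sgn_mul, sgn_mul, hh]
          cases swaps h <;> simp [hg]
        · rw [sec_mul]
          exact mul_mem (hg' _) (hh' _)
      inv_mem' := by
        rintro g ⟨hg, hg'⟩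
        refine ⟨?_, fun x => ?_⟩
        · rw [sec_inv, sec_inv, sgn_inv, sgn_inv]
          cases swaps g <;> simp [hg]
        · rw [sec_inv]
          exact inv_mem (hg' _) }

theorem mem_constrained_succ {r n : ℕ} {g : W} : g ∈ constrained r (n + 1) ↔
    sgn r (sec g false) = sgn r (sec g true) ∧ ∀ x, sec g x ∈ constrained r n := Iff.rfl

theorem constrained_succ_le (r n : ℕ) : constrained r (n + 1) ≤ constrained r n := by
  induction n with
  | zero => exact le_top
  | succ n ih => exact fun g hg => ⟨hg.1, fun x => ih (hg.2 x)⟩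

theorem constrained_anti (r : ℕ) {m n : ℕ} (h : m ≤ n) : constrained r n ≤ constrained r m :=
  antitone_nat_of_succ_le (constrained_succ_le r) h

/-- The sign of index `r` only sees the first `r` levels of a section. In particular `constrained r
n` is open, hence closed. -/
theorem stab_le_constrained (r n : ℕ) : stab (n + r) ≤ constrained r n := by
  induction n with
  | zero => exact le_top
  | succ n ih =>
    intro g hg
    rw [Nat.succ_add] at hg
    obtain ⟨-, hsec⟩ := mem_stab_succ.1 hg
    refine ⟨?_, fun x => ih (hsec x)⟩
    rw [sgn_eq_zero_of_mem_stab (by omega) (hsec _), sgn_eq_zero_of_mem_stab (by omega) (hsec _)]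

theorem isClosed_constrained (r n : ℕ) : IsClosed (constrained r n : Set W) :=
  Subgroup.isClosed_of_isOpen _ (Subgroup.isOpen_mono (stab_le_constrained r n) (isOpen_stab _))

/-- The closed self-similar group of all `g ∈ W` such that at each vertex the two sections below
that vertex have the same sign of index `r`. For `r = 0` this is `W`. -/
def levelGroup (r : ℕ) : Subgroup W := ⨅ n, constrained r n

theorem mem_levelGroup {r : ℕ} {g : W} : g ∈ levelGroup r ↔ ∀ n, g ∈ constrained r n :=
  Subgroup.mem_iInf

theorem mem_levelGroup_iff {r : ℕ} {g : W} : g ∈ levelGroup r ↔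
    sgn r (sec g false) = sgn r (sec g true) ∧ ∀ x, sec g x ∈ levelGroup r := by
  simp only [mem_levelGroup]
  constructor
  · exact fun h => ⟨(h 1).1, fun x n => (h (n + 1)).2 x⟩
  · rintro ⟨h, h'⟩ (_ | n)
    · exact Subgroup.mem_top _
    · exact ⟨h, fun x => h' x n⟩

theorem levelGroup_zero : levelGroup 0 = ⊤ := by
  have : ∀ n, constrained 0 n = ⊤ := fun n => by
    induction n with
    | zero => rfl
    | succ n ih => exact eq_top_iff.2 fun g _ => ⟨rfl, fun x => by rw [ih]; trivial⟩
  simp [levelGroup, this]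

theorem isClosed_levelGroup (r : ℕ) : IsClosed (levelGroup r : Set W) := by
  rw [levelGroup, Subgroup.coe_iInf]
  exact isClosed_iInter fun n => isClosed_constrained r n

/-! ### Model generators -/

/-- Representatives of the conjugacy classes of the generators: `σ` for `k = 1`; then
`(b_k, 1)`, except that `(b_r, b_r)` follows `b_r`. -/
def model (r : ℕ) : ℕ → W
  | 0 => 1
  | 1 => sigma
  | k + 2 => pair (model r (k + 1)) (if k + 1 = r then model r (k + 1) else 1)

theorem model_one (r : ℕ) : model r 1 = sigma := rfl

theorem model_succ {r k : ℕ} (hk : k ≠ 0) :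
    model r (k + 1) = pair (model r k) (if k = r then model r k else 1) := by
  obtain ⟨k, rfl⟩ := Nat.exists_eq_succ_of_ne_zero hk
  rfl

theorem model_mul_self (r k : ℕ) : model r k * model r k = 1 := by
  induction k with
  | zero => exact one_mul 1
  | succ k ih =>
    by_cases hk : k = 0
    · subst hk; exact sigma_mul_sigma
    · rw [model_succ hk, pair_mul, ih]
      split_ifs <;> simp [ih]

theorem model_inv (r k : ℕ) : (model r k)⁻¹ = model r k :=
  inv_eq_of_mul_eq_one_right (model_mul_self r k)

theorem model_mem_stab (r k : ℕ) : model r (k + 1) ∈ stab k := by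
  induction k with
  | zero => simp
  | succ k ih =>
    rw [model_succ (by omega), mem_stab_succ]
    refine ⟨by simp, ?_⟩
    rintro (_ | _)
    · simpa using ih
    · rw [sec_pair_true]
      split_ifs
      · exact ih
      · exact one_mem _

/-- The bound `j ≤ r` matters: for `r ≠ 0` the element `model r (r + 1)` is a pair of two equal
entries, so its sign of index `r + 1` cancels. -/
theorem sgn_model {r j : ℕ} (hj : j ≤ r) (k : ℕ) (hj0 : j ≠ 0) :
    sgn j (model r k) = if j = k then 1 else 0 := by
  induction j generalizing k with
  | zero => exact absurd rfl hj0
  | succ j ih =>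
    rcases k with _ | k
    · simp [model]
    by_cases hk : k = 0
    · subst hk
      by_cases hj : j = 0
      · subst hj; rfl
      · rw [model_one, sgn_succ hj]
        simp [hj]
    · rw [model_succ hk]
      by_cases hj : j = 0
      · subst hj
        rw [sgn_one_left, act_eq_zero_iff.2 (by simp), if_neg (by omega)]
      · rw [sgn_succ hj, sec_pair_false, sec_pair_true, ih (by omega) k hj]
        by_cases hkr : k = r
        · rw [if_pos hkr, ih (by omega) k hj, if_neg (by omega), if_neg (by omega), add_zero]
        · rw [if_neg hkr, sgn_one, add_zero]
          simp

theorem sgn_self_model {r : ℕ} (hr : r ≠ 0) (k : ℕ) :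
    sgn r (model r k) = if r = k then 1 else 0 :=
  sgn_model le_rfl k hr

theorem sgn_self_model_of_ne {r k : ℕ} (h : k ≠ r) : sgn r (model r k) = 0 := by
  by_cases hr : r = 0
  · subst hr; rfl
  · rw [sgn_self_model hr, if_neg (Ne.symm h)]

theorem model_mem (r k : ℕ) : model r k ∈ levelGroup r := by
  induction k with
  | zero => exact one_mem _
  | succ k ih =>
    by_cases hk : k = 0
    · subst hk
      exact mem_levelGroup_iff.2 ⟨rfl, fun x => one_mem _⟩
    · rw [model_succ hk, mem_levelGroup_iff]
      by_cases hkr : k = r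
      · rw [if_pos hkr]
        exact ⟨rfl, by rintro (_ | _) <;> exact ih⟩
      · rw [if_neg hkr]
        refine ⟨?_, ?_⟩
        · rw [sec_pair_false, sec_pair_true, sgn_one, sgn_self_model_of_ne hkr]
        · rintro (_ | _)
          · exact ih
          · exact one_mem _

/-! ### Characters of the constrained groups -/

/-- Functions which restrict to a basis of the continuous characters of `levelGroup r`. -/
def chi (r : ℕ) : ℕ → W → ZMod 2
  | 0, _ => 0
  | 1, g => act g
  -- On `levelGroup r` the two sections have equal sign of index `r`, so their sum would vanish;
  -- their common value is a new character instead.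
  | k + 2, g => if k + 1 = r then sgn r (sec g false) else
      chi r (k + 1) (sec g false) + chi r (k + 1) (sec g true)

@[simp] theorem chi_zero (r : ℕ) (g : W) : chi r 0 g = 0 := rfl

theorem chi_succ {r k : ℕ} (hk : k ≠ 0) (g : W) :
    chi r (k + 1) g = if k = r then sgn r (sec g false) else
      chi r k (sec g false) + chi r k (sec g true) := by
  obtain ⟨k, rfl⟩ := Nat.exists_eq_succ_of_ne_zero hk
  rfl

theorem chi_mul (r k : ℕ) {g h : W} (hg : g ∈ levelGroup r) (hh : h ∈ levelGroup r) :
    chi r k (g * h) = chi r k g + chi r k h := by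
  induction k generalizing g h with
  | zero => simp
  | succ k ih =>
    obtain ⟨hg0, hg'⟩ := mem_levelGroup_iff.1 hg
    obtain ⟨hh0, hh'⟩ := mem_levelGroup_iff.1 hh
    by_cases hk : k = 0
    · subst hk; exact act_mul g h
    · simp only [chi_succ hk]
      split_ifs with hkr
      -- It does not matter which section of `g` is met after `h` has acted, since both have the
      -- same sign.
      · rw [sec_mul, sgn_mul]
        cases swaps h <;> simp [hg0]
      · exact sum_sec_mul g h fun x y => ih (hg' x) (hh' y)

theorem chi_zero_left (k : ℕ) (g : W) : chi 0 k g = sgn k g := by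
  induction k generalizing g with
  | zero => rfl
  | succ k ih =>
    by_cases hk0 : k = 0
    · subst hk0; rfl
    · rw [chi_succ hk0, if_neg hk0, sgn_succ hk0, ih, ih]

@[simp] theorem chi_one (r k : ℕ) : chi r k 1 = 0 := by
  have := chi_mul r k (one_mem (levelGroup r)) (one_mem (levelGroup r))
  simpa using this

theorem chi_eq_zero_of_mem_stab (r : ℕ) {n j : ℕ} (h : j ≤ n) {g : W} (hg : g ∈ stab n) :
    chi r j g = 0 := by
  induction n generalizing j g with
  | zero => simp [Nat.le_zero.1 h]
  | succ n ih =>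
    obtain ⟨hs, hsec⟩ := mem_stab_succ.1 hg
    rcases j with _ | j
    · rfl
    by_cases hj : j = 0
    · subst hj; exact act_eq_zero_iff.2 hs
    rw [chi_succ hj]
    split_ifs with hr
    · exact sgn_eq_zero_of_mem_stab (by omega) (hsec _)
    · rw [ih (by omega) (hsec _), ih (by omega) (hsec _), add_zero]

/-- Duality of characters and models. At the step from `r` to `r + 1`, the doubled entry of the
model is matched by taking only one section in `chi`. -/
theorem chi_model (r : ℕ) {j k : ℕ} (hj : j ≠ 0) :
    chi r j (model r k) = if j = k then 1 else 0 := by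
  induction j generalizing k with
  | zero => exact absurd rfl hj
  | succ j ih =>
    rcases k with _ | k
    · simp [model]
    by_cases hk : k = 0
    · subst hk
      by_cases hj : j = 0
      · subst hj; rfl
      · rw [model_one, chi_succ hj]
        simp [hj]
    rw [model_succ hk]
    by_cases hj : j = 0
    · subst hj
      rw [if_neg (show ¬ (0 + 1 = k + 1) by omega)]
      exact act_eq_zero_iff.2 (by simp)
    rw [chi_succ hj, sec_pair_false, sec_pair_true]
    by_cases hjr : j = r
    · subst hjr
      rw [if_pos rfl, sgn_self_model hj]
      simp
    · rw [if_neg hjr, ih hj]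
      by_cases hkr : k = r
      · rw [if_pos hkr, ih hj, if_neg (by omega), if_neg (by omega), add_zero]
      · rw [if_neg hkr, chi_one, add_zero]
        simp

/-- The sections of a conjugate of a model generator. -/
theorem sec_of_isConj_model {r k : ℕ} (hk : k ≠ 0) {z : W} (h : IsConj (model r (k + 1)) z) :
    swaps z = false ∧ ∃ x, IsConj (model r k) (sec z x) ∧
      if k = r then IsConj (model r k) (sec z !x) else sec z (!x) = 1 := by
  obtain ⟨c, rfl⟩ := isConj_iff.1 h
  rw [model_succ hk]
  refine ⟨by simp [swaps_mul, swaps_inv], swaps c, ?_⟩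
  by_cases hkr : k = r
  · cases hc : swaps c <;> simp [sec_mul, sec_inv, swaps_inv, hc, hkr]
  · cases hc : swaps c <;> simp [sec_mul, sec_inv, swaps_inv, hc, hkr]

/-- An element of `levelGroup r` which is conjugate in `W` to `model r k` has leading index `k`. -/
theorem chi_of_isConj_model (r : ℕ) {k : ℕ} (hk : k ≠ 0) {z : W} (hz : z ∈ levelGroup r)
    (h : IsConj (model r k) z) : (∀ j < k, chi r j z = 0) ∧ chi r k z = 1 := by
  suffices H : ∀ j ≤ k, chi r j z = if j = k then 1 else 0 from
    ⟨fun j hj => by rw [H j hj.le, if_neg hj.ne], by rw [H k le_rfl, if_pos rfl]⟩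
  induction k generalizing z with
  | zero => exact absurd rfl hk
  | succ k ih =>
    rintro (_ | j) hj
    · simp
    by_cases hk0 : k = 0
    · subst hk0
      obtain rfl : j = 0 := by omega
      have := sgn_eq_of_isConj 1 h
      rw [model_one] at this
      exact this.symm
    obtain ⟨hs, x, h1, h2⟩ := sec_of_isConj_model hk0 h
    obtain ⟨hz0, hz'⟩ := mem_levelGroup_iff.1 hz
    by_cases hj0 : j = 0
    · subst hj0
      rw [if_neg (by omega)]
      exact act_eq_zero_iff.2 hs
    rw [chi_succ hj0]
    by_cases hjr : j = r
    · have e : sgn r (sec z false) = sgn r (sec z x) := by cases x <;> simp [hz0]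
      subst hjr
      rw [if_pos rfl, e, ← sgn_eq_of_isConj j h1, sgn_self_model hj0]
      simp
    · have e : chi r j (sec z false) + chi r j (sec z true) =
          chi r j (sec z x) + chi r j (sec z !x) := by cases x <;> simp [add_comm]
      rw [if_neg hjr, e, ih hk0 (hz' _) h1 j (by omega)]
      by_cases hkr : k = r
      · rw [if_pos hkr] at h2
        rw [ih hk0 (hz' _) h2 j (by omega), if_neg (by omega), if_neg (by omega), add_zero]
      · rw [if_neg hkr] at h2
        rw [h2, chi_one, add_zero]
        simp

/-! ### Generation of the constrained groups -/

/-- The subgroup generated by the model generators. -/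
def modelGroup (r : ℕ) : Subgroup W := Subgroup.closure (Set.range (model r))

theorem model_mem_modelGroup (r k : ℕ) : model r k ∈ modelGroup r :=
  Subgroup.subset_closure ⟨k, rfl⟩

theorem modelGroup_le (r : ℕ) : modelGroup r ≤ levelGroup r :=
  (Subgroup.closure_le _).2 (by rintro _ ⟨k, rfl⟩; exact model_mem r k)

/-- Each `model r k` is the first entry of `model r (k + 1)`. The second entry is not controlled
here. -/
theorem exists_pair_mem_modelGroup {r : ℕ} {l : W} (hl : l ∈ modelGroup r) :
    ∃ l', pair l l' ∈ modelGroup r := by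
  induction hl using Subgroup.closure_induction with
  | mem x hx =>
    obtain ⟨k, rfl⟩ := hx
    by_cases hk : k = 0
    · subst hk
      exact ⟨1, by rw [model, pair_one_one]; exact one_mem _⟩
    · exact ⟨_, by rw [← model_succ hk]; exact model_mem_modelGroup r _⟩
  | one => exact ⟨1, by rw [pair_one_one]; exact one_mem _⟩
  | mul x y _ _ hx hy =>
    obtain ⟨x', hx⟩ := hx
    obtain ⟨y', hy⟩ := hy
    exact ⟨x' * y', by rw [← pair_mul]; exact mul_mem hx hy⟩
  | inv x _ hx =>
    obtain ⟨x', hx⟩ := hx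
    exact ⟨x'⁻¹, by rw [← pair_inv]; exact inv_mem hx⟩

theorem pair_one_model_mem {r k : ℕ} (hk : k ≠ r) : pair 1 (model r k) ∈ modelGroup r := by
  by_cases hk0 : k = 0
  · subst hk0
    rw [model, pair_one_one]; exact one_mem _
  · have h := model_mem_modelGroup r (k + 1)
    rw [model_succ hk0, if_neg hk] at h
    rw [← sigma_mul_pair_mul_sigma]
    exact mul_mem (mul_mem (model_mem_modelGroup r 1) h) (model_mem_modelGroup r 1)

/-- Every model except `model r r` occurs alone in the second entry; `model r r` only occurs paired
with itself, so it can act there only by conjugation. Writing `l` as a word, such conjugations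
insert two copies of `model r r` at a time, and the parity of the number of copies is `sgn r l`. The
second clause carries an odd word through the induction. -/
theorem pair_one_mem_modelGroup {r : ℕ} {l : W} (hl : l ∈ modelGroup r) :
    (sgn r l = 0 → pair 1 l ∈ modelGroup r) ∧
      (sgn r l = 1 → pair 1 (l * model r r) ∈ modelGroup r) := by
  have hconj : ∀ {x : W}, r ≠ 0 → pair 1 x ∈ modelGroup r →
      pair 1 (model r r * x * model r r) ∈ modelGroup r := fun {x} hr hx => by
    have h := model_mem_modelGroup r (r + 1)
    rw [model_succ hr, if_pos rfl] at h
    have := mul_mem (mul_mem h hx) h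
    rwa [pair_mul, pair_mul, mul_one, model_mul_self] at this
  have step : ∀ (k : ℕ) (y : W), ((sgn r y = 0 → pair 1 y ∈ modelGroup r) ∧
      (sgn r y = 1 → pair 1 (y * model r r) ∈ modelGroup r)) →
      (sgn r (model r k * y) = 0 → pair 1 (model r k * y) ∈ modelGroup r) ∧
      (sgn r (model r k * y) = 1 → pair 1 (model r k * y * model r r) ∈ modelGroup r) := by
    intro k y ih
    by_cases hk : k = r
    · subst hk
      by_cases hr : k = 0
      · subst hr
        exact ⟨fun _ => by simpa [model] using ih.1 rfl, fun h => by simp at h⟩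
      rw [sgn_mul, sgn_self_model hr, if_pos rfl]
      refine ⟨fun h => ?_, fun h => ?_⟩
      · have hy1 : sgn k y = 1 := by rwa [add_comm, CharTwo.add_eq_zero] at h
        have := hconj hr (ih.2 hy1)
        rwa [mul_assoc, mul_assoc, model_mul_self, mul_one] at this
      · exact hconj hr (ih.1 (by simpa using h))
    · rw [sgn_mul, sgn_self_model_of_ne hk, zero_add]
      refine ⟨fun h => ?_, fun h => ?_⟩
      · rw [← one_mul (1 : W), ← pair_mul]
        exact mul_mem (pair_one_model_mem hk) (ih.1 h)
      · rw [← one_mul (1 : W), mul_assoc, ← pair_mul]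
        exact mul_mem (pair_one_model_mem hk) (ih.2 h)
  induction hl using Subgroup.closure_induction_left with
  | one => exact ⟨fun _ => by rw [pair_one_one]; exact one_mem _, fun h => by simp at h⟩
  | mul_left x hx y hy ih =>
    obtain ⟨k, rfl⟩ := hx
    exact step k y ih
  | inv_mul_cancel x hx y hy ih =>
    obtain ⟨k, rfl⟩ := hx
    rw [model_inv]
    exact step k y ih

/-- The error term in an approximation by `modelGroup r` can be chosen with trivial sign. -/
theorem exists_approx_sgn_eq_zero {r n : ℕ} {u : W}
    (h : ∃ l ∈ modelGroup r, l⁻¹ * u ∈ stab n) :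
    ∃ l ∈ modelGroup r, l⁻¹ * u ∈ stab n ∧ sgn r (l⁻¹ * u) = 0 := by
  obtain ⟨l, hl, hs⟩ := h
  by_cases h0 : sgn r (l⁻¹ * u) = 0
  · exact ⟨l, hl, hs, h0⟩
  have hnr : n < r := by
    by_contra hc
    exact h0 (sgn_eq_zero_of_mem_stab (not_lt.1 hc) hs)
  have hr : r ≠ 0 := by omega
  -- The error can have nonzero sign only if `n < r`, and then `model r r` corrects the sign without
  -- disturbing the first `n` levels.
  have hm : model r r ∈ stab n := by
    obtain ⟨r', rfl⟩ := Nat.exists_eq_succ_of_ne_zero hr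
    exact stab_anti (by omega) (model_mem_stab _ r')
  refine ⟨l * model r r, mul_mem hl (model_mem_modelGroup r r), ?_, ?_⟩
  · rw [mul_inv_rev, model_inv, mul_assoc]
    exact mul_mem hm hs
  · rw [mul_inv_rev, model_inv, mul_assoc, sgn_mul, zmod_two_eq_one_of_ne_zero h0,
      sgn_self_model hr, if_pos rfl]
    rfl

/-- The model generators generate a dense subgroup of `levelGroup r`. -/
theorem exists_modelGroup_approx (r n : ℕ) {g : W} (hg : g ∈ levelGroup r) :
    ∃ l ∈ modelGroup r, l⁻¹ * g ∈ stab n := by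
  induction n generalizing g with
  | zero => exact ⟨1, one_mem _, by simp⟩
  | succ n ih =>
    suffices H : ∀ g ∈ levelGroup r, swaps g = false → ∃ l ∈ modelGroup r, l⁻¹ * g ∈ stab (n + 1) by
      cases hs : swaps g
      · exact H g hg hs
      · obtain ⟨l, hl, h⟩ := H (sigma * g) (mul_mem (model_mem r 1) hg) (by simp [swaps_mul, hs])
        refine ⟨sigma * l, mul_mem (model_mem_modelGroup r 1) hl, ?_⟩
        rwa [mul_inv_rev, sigma_inv, mul_assoc]
    intro g hg hs
    -- The first section is matched by a pair from `modelGroup r`. The leftover first entry has sign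
    -- zero, so membership in `levelGroup r` forces the leftover second entry `z` to have sign zero
    -- as well.
    obtain ⟨l, hl, hls, hl0⟩ := exists_approx_sgn_eq_zero (ih ((mem_levelGroup_iff.1 hg).2 false))
    obtain ⟨l', hl'⟩ := exists_pair_mem_modelGroup hl
    set z := l'⁻¹ * sec g true with hz
    have hg' : pair (l⁻¹ * sec g false) z = (pair l l')⁻¹ * g := by
      conv_rhs => rw [eq_pair hs, pair_inv, pair_mul]
    have hM : pair (l⁻¹ * sec g false) z ∈ levelGroup r := by
      rw [hg']; exact mul_mem (inv_mem (modelGroup_le r hl')) hg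
    obtain ⟨hM0, hM1⟩ := mem_levelGroup_iff.1 hM
    have hz0 : sgn r z = 0 := by
      rw [sec_pair_false, sec_pair_true, hl0] at hM0
      exact hM0.symm
    obtain ⟨k, hk, hks, hk0⟩ := exists_approx_sgn_eq_zero (ih (hM1 true))
    rw [sec_pair_true] at hks hk0
    -- With `k` of sign zero, `pair 1 k` lies in `modelGroup r`, and it corrects the second entry
    -- while leaving the first alone.
    have hsk : sgn r k = 0 := by
      rwa [sgn_mul, hz0, add_zero, sgn_inv] at hk0
    refine ⟨pair l l' * pair 1 k, mul_mem hl' ((pair_one_mem_modelGroup hk).1 hsk), ?_⟩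
    rw [mul_inv_rev, mul_assoc, ← hg', pair_inv, pair_mul, mem_stab_succ]
    refine ⟨swaps_pair _ _, ?_⟩
    rintro (_ | _)
    · simpa using hls
    · exact hks

/-! ### A criterion for generation -/

/-- A maximal subgroup `N` of a finite 2-group is normal. The centre of the quotient is nontrivial,
so its preimage strictly contains `N` and is everything; the quotient is therefore commutative. -/
theorem exists_comm_quotient {Γ : Type*} [Group Γ] [Finite Γ] (hp : IsPGroup 2 Γ)
    {H : Subgroup Γ} (hH : H ≠ ⊤) :
    ∃ N : Subgroup Γ, N.Normal ∧ H ≤ N ∧ N ≠ ⊤ ∧ ∀ a b : Γ, a⁻¹ * b⁻¹ * a * b ∈ N := by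
  obtain ⟨N, hN, hHN⟩ := (eq_top_or_exists_le_coatom H).resolve_left hH
  have : Fact (Nat.Prime 2) := ⟨Nat.prime_two⟩
  have hnil : Group.IsNilpotent Γ := hp.isNilpotent
  have hnorm : N.Normal := Subgroup.NormalizerCondition.normal_of_coatom N Group.normalizerCondition_of_isNilpotent hN
  refine ⟨N, hnorm, hHN, hN.1, ?_⟩
  have hnt : Nontrivial (Γ ⧸ N) := QuotientGroup.nontrivial_iff.2 hN.1
  have hc := (hp.to_quotient N).center_nontrivial
  have htop : (Subgroup.center (Γ ⧸ N)).comap (QuotientGroup.mk' N) = ⊤ := by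
    refine hN.2 _ (lt_of_le_of_ne ?_ fun h => ?_)
    · intro x hx
      rw [Subgroup.mem_comap, QuotientGroup.mk'_apply, (QuotientGroup.eq_one_iff x).2 hx]
      exact one_mem _
    · obtain ⟨⟨y, hy⟩, hne⟩ := exists_ne (1 : Subgroup.center (Γ ⧸ N))
      obtain ⟨x, rfl⟩ := QuotientGroup.mk_surjective y
      have : x ∈ N := by rw [h]; exact hy
      exact hne (Subtype.ext ((QuotientGroup.eq_one_iff x).2 this))
  intro a b
  have ha : a ∈ (Subgroup.center (Γ ⧸ N)).comap (QuotientGroup.mk' N) := htop ▸ Subgroup.mem_top a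
  have hab := Subgroup.mem_center_iff.1 (Subgroup.mem_comap.1 ha) (b : Γ ⧸ N)
  rw [← QuotientGroup.eq_one_iff, mul_assoc, ← mul_inv_rev]
  rw [QuotientGroup.mk_mul, QuotientGroup.mk_inv, inv_mul_eq_one]
  exact hab

/-- The power `x ^ z` of an involution `x` with exponent in `ZMod 2`. -/
def invoPow {A : Type*} [One A] (x : A) (z : ZMod 2) : A := if z = 0 then 1 else x

theorem invoPow_add {A : Type*} [Monoid A] {x : A} (hx : x * x = 1) (y z : ZMod 2) :
    invoPow x (y + z) = invoPow x y * invoPow x z := by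
  unfold invoPow
  by_cases hy : y = 0
  · simp [hy]
  by_cases hz : z = 0
  · simp [hz]
  rw [zmod_two_eq_one_of_ne_zero hy, zmod_two_eq_one_of_ne_zero hz, if_neg one_ne_zero, hx]
  rfl

/-- Homomorphisms from `levelGroup r` to commutative groups are expressed through the `chi r j`. -/
theorem hom_eq_prod {r n : ℕ} {A : Type*} [CommGroup A] (φ : levelGroup r →* A)
    (hφ : ∀ g : levelGroup r, (g : W) ∈ stab n → φ g = 1) (g : levelGroup r) :
    φ g = ∏ j ∈ Finset.Icc 1 n, invoPow (φ ⟨model r j, model_mem r j⟩) (chi r j g) := by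
  have hsq : ∀ j, φ ⟨model r j, model_mem r j⟩ * φ ⟨model r j, model_mem r j⟩ = 1 := fun j => by
    rw [← map_mul, ← map_one φ]
    exact congrArg φ (Subtype.ext (model_mul_self r j))
  -- Both sides are homomorphisms trivial on `stab n`. By duality they agree on the models, hence on
  -- the dense subgroup `modelGroup r`, hence everywhere.
  let ψ : levelGroup r →* A :=
    { toFun := fun g => ∏ j ∈ Finset.Icc 1 n, invoPow (φ ⟨model r j, model_mem r j⟩) (chi r j g)
      map_one' := Finset.prod_eq_one fun j _ => by simp [invoPow]
      map_mul' := fun g h => by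
        rw [← Finset.prod_mul_distrib]
        refine Finset.prod_congr rfl fun j _ => ?_
        rw [← invoPow_add (hsq j), ← chi_mul r j g.2 h.2]
        rfl }
  change φ g = ψ g
  have hψ : ∀ g : levelGroup r, (g : W) ∈ stab n → ψ g = 1 := fun g hg => by
    change ∏ j ∈ Finset.Icc 1 n, invoPow (φ ⟨model r j, model_mem r j⟩) (chi r j g) = 1
    exact Finset.prod_eq_one fun j hj => by
      rw [chi_eq_zero_of_mem_stab r (Finset.mem_Icc.1 hj).2 hg, invoPow, if_pos rfl]
  have hmodel : ∀ k, φ ⟨model r k, model_mem r k⟩ = ψ ⟨model r k, model_mem r k⟩ := fun k => by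
    by_cases hk : k ∈ Finset.Icc 1 n
    · change _ = ∏ j ∈ Finset.Icc 1 n, invoPow (φ ⟨model r j, model_mem r j⟩) (chi r j (model r k))
      rw [Finset.prod_eq_single_of_mem k hk, chi_model r (by simp at hk; omega), if_pos rfl, invoPow,
        if_neg one_ne_zero]
      intro j hj hjk
      rw [chi_model r (by simp at hj; omega), if_neg hjk, invoPow, if_pos rfl]
    · have : model r k ∈ stab n := by
        rcases k with _ | k
        · exact one_mem _
        · exact stab_anti (by simp at hk; omega) (model_mem_stab r k)
      rw [hφ _ this, hψ _ this]
  have hgroup : ∀ l (hl : l ∈ modelGroup r),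
      φ ⟨l, modelGroup_le r hl⟩ = ψ ⟨l, modelGroup_le r hl⟩ := fun l hl => by
    induction hl using Subgroup.closure_induction with
    | mem x hx => obtain ⟨k, rfl⟩ := hx; exact hmodel k
    | one => exact (map_one φ).trans (map_one ψ).symm
    | mul x y hx hy ihx ihy =>
      have := congrArg₂ (· * ·) ihx ihy
      simp only [← map_mul] at this
      exact this
    | inv x hx ih =>
      have := congrArg (·⁻¹) ih
      simp only [← map_inv] at this
      exact this
  obtain ⟨l, hl, hs⟩ := exists_modelGroup_approx r n g.2
  have e : g = ⟨l, modelGroup_le r hl⟩ * ⟨l⁻¹ * g, mul_mem (inv_mem (modelGroup_le r hl)) g.2⟩ :=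
    Subtype.ext (by simp)
  rw [e, map_mul, map_mul, hgroup l hl, hφ ⟨l⁻¹ * g, _⟩ hs, hψ ⟨l⁻¹ * g, _⟩ hs]

/-- A Frattini-type argument. If `H` were proper modulo some `stab n`, a nontrivial homomorphism `φ`
to an abelian group would kill `H`. An element of `H` with leading index `k` expresses `φ` of `model
r k` through `φ` of later models, so descending induction on `k` makes `φ` trivial. -/
theorem eq_levelGroup_of_leading {r : ℕ} {H : Subgroup W} (hH : IsClosed (H : Set W))
    (hle : H ≤ levelGroup r)
    (hlead : ∀ k, k ≠ 0 → ∃ g ∈ H, (∀ j < k, chi r j g = 0) ∧ chi r k g = 1) :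
    H = levelGroup r := by
  refine le_antisymm hle fun g hg => ?_
  rw [← SetLike.mem_coe, ← hH.closure_eq]
  refine mem_topologicalClosure_of_forall fun n => ?_
  let K : Subgroup (levelGroup r) := (stab n).subgroupOf (levelGroup r)
  have hfin : Finite (W ⧸ stab n) := Subgroup.quotient_finite_of_isOpen _ (isOpen_stab n)
  have hfi : (stab n).FiniteIndex := Subgroup.finiteIndex_of_finite_quotient
  have hfinK : Finite (levelGroup r ⧸ K) := inferInstance
  have hp : IsPGroup 2 (levelGroup r ⧸ K) := by
    intro q
    obtain ⟨x, rfl⟩ := QuotientGroup.mk_surjective q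
    refine ⟨n, ?_⟩
    rw [← QuotientGroup.mk_pow]
    exact (QuotientGroup.eq_one_iff _).2 (pow_two_pow_mem_stab n (x : W))
  by_cases htop : (H.subgroupOf (levelGroup r)).map (QuotientGroup.mk' K) = ⊤
  · have : QuotientGroup.mk' K ⟨g, hg⟩ ∈ (H.subgroupOf (levelGroup r)).map (QuotientGroup.mk' K) :=
      htop ▸ Subgroup.mem_top _
    obtain ⟨k, hk, hkg⟩ := Subgroup.mem_map.1 this
    exact ⟨k, hk, QuotientGroup.eq (s := K).1 hkg⟩
  exfalso
  obtain ⟨N, hN, hHN, hNtop, hcomm⟩ := exists_comm_quotient hp htop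
  let _ : CommGroup ((levelGroup r ⧸ K) ⧸ N) :=
    { QuotientGroup.Quotient.group N with
      mul_comm := by
        intro a b
        obtain ⟨a, rfl⟩ := QuotientGroup.mk_surjective a
        obtain ⟨b, rfl⟩ := QuotientGroup.mk_surjective b
        refine (QuotientGroup.eq.2 ?_).symm
        have := hcomm a b
        rwa [mul_inv_rev, ← mul_assoc] }
  let φ : levelGroup r →* (levelGroup r ⧸ K) ⧸ N :=
    (QuotientGroup.mk' N).comp (QuotientGroup.mk' K)
  have hφ : ∀ x : levelGroup r, (x : W) ∈ stab n → φ x = 1 := fun x hx => by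
    change QuotientGroup.mk' N (QuotientGroup.mk' K x) = 1
    rw [show QuotientGroup.mk' K x = 1 from (QuotientGroup.eq_one_iff x).2 hx, map_one]
  have hφH : ∀ x : levelGroup r, (x : W) ∈ H → φ x = 1 := fun x hx =>
    (QuotientGroup.eq_one_iff (N := N) _).2 (hHN (Subgroup.mem_map.2 ⟨x, hx, rfl⟩))
  -- Descending induction on `j`, with `i` bounding the distance to the trivial range `j > n`, where
  -- the model lies in `stab n`.
  have hm : ∀ i j, j ≠ 0 → n < j + i → φ ⟨model r j, model_mem r j⟩ = 1 := by
    intro i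
    induction i with
    | zero =>
      intro j hj hn
      obtain ⟨j, rfl⟩ := Nat.exists_eq_succ_of_ne_zero hj
      exact hφ _ (stab_anti (by omega) (model_mem_stab r j))
    | succ i ih =>
      intro k hk hn
      by_cases hkn : n < k
      · exact ih k hk (by omega)
      obtain ⟨x, hx, hx0, hx1⟩ := hlead k hk
      have h1 := hom_eq_prod φ hφ ⟨x, hle hx⟩
      rw [hφH _ hx, Finset.prod_eq_single_of_mem k (by simp; omega)] at h1
      · rw [hx1, invoPow, if_neg one_ne_zero] at h1
        exact h1.symm
      · intro j hj hjk
        rcases lt_or_gt_of_ne hjk with h | h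
        · rw [hx0 j h, invoPow, if_pos rfl]
        · rw [ih j (by omega) (by omega), invoPow, ite_self]
  refine hNtop (eq_top_iff.2 fun q _ => ?_)
  obtain ⟨x, rfl⟩ := QuotientGroup.mk_surjective q
  rw [← QuotientGroup.eq_one_iff]
  change φ x = 1
  rw [hom_eq_prod φ hφ x]
  refine Finset.prod_eq_one fun j hj => ?_
  rw [hm n j (by simp at hj; omega) (by simp at hj; omega), invoPow, ite_self]

/-! ### Products of conjugates of the model generators -/

/-- A list of elements of `W`, each with an index `k` such that it is conjugate to `model r k`. -/
def Typed (r : ℕ) (L : List (ℕ × W)) : Prop := ∀ e ∈ L, e.1 ≠ 0 ∧ IsConj (model r e.1) e.2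

/-- The product of the elements of a typed list. -/
def listProd (L : List (ℕ × W)) : W := (L.map Prod.snd).prod

/-- The number of elements of index `k` in a typed list. -/
def indexCount (k : ℕ) (L : List (ℕ × W)) : ℕ := (L.map Prod.fst).count k

theorem Typed.append {r : ℕ} {L L' : List (ℕ × W)} (h : Typed r L) (h' : Typed r L') :
    Typed r (L ++ L') := fun e he => (List.mem_append.1 he).elim (h e) (h' e)

@[simp] theorem listProd_nil : listProd [] = 1 := rfl

@[simp] theorem listProd_cons (e : ℕ × W) (L : List (ℕ × W)) :
    listProd (e :: L) = e.2 * listProd L := by simp [listProd]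

@[simp] theorem listProd_append (L L' : List (ℕ × W)) :
    listProd (L ++ L') = listProd L * listProd L' := by simp [listProd]

@[simp] theorem indexCount_nil (k : ℕ) : indexCount k [] = 0 := rfl

@[simp] theorem indexCount_append (k : ℕ) (L L' : List (ℕ × W)) :
    indexCount k (L ++ L') = indexCount k L + indexCount k L' := by simp [indexCount]

theorem indexCount_cons (k : ℕ) (e : ℕ × W) (L : List (ℕ × W)) :
    indexCount k (e :: L) = indexCount k L + if e.1 = k then 1 else 0 := by
  simp [indexCount, List.count_cons]

theorem listProd_mem {S : Subgroup W} {L : List (ℕ × W)} (h : ∀ e ∈ L, e.2 ∈ S) :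
    listProd L ∈ S :=
  S.list_prod_mem fun x hx => by
    obtain ⟨e, he, rfl⟩ := List.mem_map.1 hx
    exact h e he

theorem exists_eq_append_cons {k : ℕ} {L : List (ℕ × W)} (h : indexCount k L ≠ 0) :
    ∃ L₀ s L₁, L = L₀ ++ (k, s) :: L₁ ∧ indexCount k L₀ = 0 := by
  induction L with
  | nil => exact absurd rfl h
  | cons e L ih =>
    by_cases he : e.1 = k
    · exact ⟨[], e.2, L, by simp [← he], rfl⟩
    · rw [indexCount_cons, if_neg he] at h
      obtain ⟨L₀, s, L₁, rfl, h0⟩ := ih h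
      exact ⟨e :: L₀, s, L₁, rfl, by rw [indexCount_cons, if_neg he, h0]⟩

theorem fst_ne_of_indexCount_eq_zero {k : ℕ} {L : List (ℕ × W)} (h : indexCount k L = 0)
    {e : ℕ × W} (he : e ∈ L) : e.1 ≠ k := fun hk =>
  List.count_eq_zero.1 h (List.mem_map.2 ⟨e, he, hk⟩)

theorem exists_sections_singleton {r k : ℕ} (hk : k ≠ 0) {z : W}
    (h : IsConj (model r (k + 1)) z) :
    ∃ X Y : List (ℕ × W), Typed r X ∧ Typed r Y ∧ swaps z = false ∧
      sec z false = listProd X ∧ sec z true = listProd Y ∧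
      ∀ j, indexCount j X + indexCount j Y = (if j = r then 2 else 1) * if k = j then 1 else 0 := by
  obtain ⟨hs, x, h1, h2⟩ := sec_of_isConj_model hk h
  obtain ⟨Y, hY, hYp, hYc⟩ : ∃ Y : List (ℕ × W), Typed r Y ∧ sec z (!x) = listProd Y ∧
      ∀ j, (if k = j then 1 else 0) + indexCount j Y =
        (if j = r then 2 else 1) * if k = j then 1 else 0 := by
    by_cases hkr : k = r
    · rw [if_pos hkr] at h2
      refine ⟨[(k, sec z !x)], by simpa [Typed, -isConj_iff] using ⟨hk, h2⟩, by simp, fun j => ?_⟩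
      rw [indexCount_cons]
      split_ifs <;> simp_all
    · rw [if_neg hkr] at h2
      refine ⟨[], by simp [Typed], by simpa using h2, fun j => ?_⟩
      split_ifs <;> simp_all
  have hX : Typed r [(k, sec z x)] := by simpa [Typed, -isConj_iff] using ⟨hk, h1⟩
  have hXc : ∀ j, indexCount j [(k, sec z x)] = if k = j then 1 else 0 := fun j => by
    rw [indexCount_cons, indexCount_nil, zero_add]
  cases x
  · exact ⟨_, Y, hX, hY, hs, by simp, hYp, fun j => by rw [hXc, hYc]⟩
  · exact ⟨Y, _, hY, hX, hs, hYp, by simp, fun j => by rw [add_comm, hXc, hYc]⟩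

/-- Without factors of index 1, every factor fixes level one, so the sections of the product are
products of the sections of the factors, again conjugates of models with index lowered by one. The
final clause allows membership statements about these sections to be carried back to the factors of
`L`. -/
theorem exists_sections {r : ℕ} {L : List (ℕ × W)} (hL : Typed r L) (h1 : indexCount 1 L = 0) :
    ∃ X Y : List (ℕ × W), Typed r X ∧ Typed r Y ∧ swaps (listProd L) = false ∧
      sec (listProd L) false = listProd X ∧ sec (listProd L) true = listProd Y ∧
      (∀ j, j ≠ 0 → indexCount j X + indexCount j Y =
        (if j = r then 2 else 1) * indexCount (j + 1) L) ∧
      ∀ S : Subgroup W, (∀ e ∈ X, e.2 ∈ S) → (∀ e ∈ Y, e.2 ∈ S) →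
        ∀ e ∈ L, swaps e.2 = false ∧ ∀ x, sec e.2 x ∈ S := by
  induction L with
  | nil => exact ⟨[], [], by simp [Typed], by simp [Typed], rfl, rfl, rfl, by simp, by simp⟩
  | cons e L ih =>
    obtain ⟨he0, he⟩ := hL e List.mem_cons_self
    have he1 : e.1 ≠ 1 := fst_ne_of_indexCount_eq_zero h1 List.mem_cons_self
    rw [indexCount_cons] at h1
    obtain ⟨X, Y, hX, hY, hs, hXp, hYp, hc, hS⟩ :=
      ih (fun e he => hL e (List.mem_cons_of_mem _ he)) (by omega)
    obtain ⟨k, hk⟩ := Nat.exists_eq_succ_of_ne_zero he0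
    rw [hk] at he
    obtain ⟨X₀, Y₀, hX₀, hY₀, hs₀, hXp₀, hYp₀, hc₀⟩ := exists_sections_singleton (by omega) he
    refine ⟨X₀ ++ X, Y₀ ++ Y, hX₀.append hX, hY₀.append hY, by simp [swaps_mul, hs, hs₀],
      by simp [sec_mul, hs, hXp, hXp₀], by simp [sec_mul, hs, hYp, hYp₀], fun j hj => ?_,
      fun S hSX hSY e' he' => ?_⟩
    · have e1 : (if e.1 = j + 1 then 1 else 0) = if k = j then 1 else 0 :=
        if_congr (by omega) rfl rfl
      rw [indexCount_append, indexCount_append, indexCount_cons, mul_add, ← hc j hj, e1, ← hc₀ j]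
      omega
    · rcases List.mem_cons.1 he' with rfl | he'
      · refine ⟨hs₀, ?_⟩
        rintro (_ | _)
        · rw [hXp₀]
          exact listProd_mem fun e he => hSX e (List.mem_append_left _ he)
        · rw [hYp₀]
          exact listProd_mem fun e he => hSY e (List.mem_append_left _ he)
      · exact hS S (fun e he => hSX e (List.mem_append_right _ he))
          (fun e he => hSY e (List.mem_append_right _ he)) e' he'

theorem sgn_model_sections (r k : ℕ) :
    sgn r (sec (model r k) false) = sgn r (sec (model r k) true) :=
  (mem_levelGroup_iff.1 (model_mem r k)).1

/-- For `r ≠ 0` the condition says that `sgn (r + 1)` vanishes, which is invariant under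
conjugation. Thus the defining condition of `levelGroup r` at the root is automatic for every
conjugate of a model. -/
theorem sgn_sections_of_isConj {r k : ℕ} {z : W} (h : IsConj (model r k) z) :
    sgn r (sec z false) = sgn r (sec z true) := by
  by_cases hr : r = 0
  · subst hr; rfl
  have h1 := sgn_eq_of_isConj (r + 1) h
  rw [sgn_succ hr, sgn_succ hr, sgn_model_sections, CharTwo.add_self_eq_zero, eq_comm,
    CharTwo.add_eq_zero] at h1
  exact h1

/-- Conjugating a typed list entrywise. -/
def conjList (w : W) (L : List (ℕ × W)) : List (ℕ × W) := L.map fun e => (e.1, w * e.2 * w⁻¹)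

theorem Typed.conjList {r : ℕ} {L : List (ℕ × W)} (h : Typed r L) (w : W) :
    Typed r (conjList w L) := by
  intro e' he'
  obtain ⟨e, he, rfl⟩ := List.mem_map.1 he'
  exact ⟨(h e he).1, (h e he).2.trans (isConj_iff.2 ⟨w, rfl⟩)⟩

theorem indexCount_conjList (k : ℕ) (w : W) (L : List (ℕ × W)) :
    indexCount k (conjList w L) = indexCount k L := by
  simp [indexCount, BinTree.conjList, Function.comp_def]

theorem listProd_conjList (w : W) (L : List (ℕ × W)) :
    listProd (conjList w L) = w * listProd L * w⁻¹ := by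
  induction L with
  | nil => simp [BinTree.conjList]
  | cons e L ih =>
    have : conjList w (e :: L) = (e.1, w * e.2 * w⁻¹) :: conjList w L := rfl
    rw [this, listProd_cons, listProd_cons, ih]
    group

/-- Conjugating by `pair w w` conjugates the sections. -/
theorem conj_pair_mem_constrained {r n : ℕ} {w z : W}
    (h0 : sgn r (sec z false) = sgn r (sec z true))
    (h : ∀ x, w * sec z x * w⁻¹ ∈ constrained r n) :
    pair w w * z * (pair w w)⁻¹ ∈ constrained r (n + 1) := by
  have hw : ∀ x, sec (pair w w) x = w := by rintro (_ | _) <;> rfl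
  have hsec : ∀ x, sec (pair w w * z * (pair w w)⁻¹) x = w * sec z x * w⁻¹ := fun x => by
    rw [sec_mul, sec_mul, sec_inv, swaps_inv, swaps_pair, Bool.xor_false, hw, hw]
  rw [mem_constrained_succ]
  refine ⟨?_, fun x => by rw [hsec]; exact h x⟩
  rw [hsec, hsec, sgn_conj, sgn_conj, h0]

/-- Modulo `N`, the second relation solves for `u`, and substituting it into the first leaves a
relation without `u`. -/
theorem mk_eq_of_mul_mem {N : Subgroup W} [N.Normal] {x₀ x₁ x₂ y₀ y₁ y₂ u : W}
    (h1 : x₀ * y₁ * u * x₂ ∈ N) (h2 : y₀ * x₁ * u⁻¹ * y₂ ∈ N) :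
    (y₂ * y₀ * x₁)⁻¹ * u ∈ N ∧ x₀ * y₁ * y₂ * y₀ * x₁ * x₂ ∈ N := by
  have hu : y₂ * y₀ * x₁ * u⁻¹ ∈ N := by
    have := Subgroup.Normal.conj_mem ‹_› _ h2 y₂
    convert this using 1
    group
  constructor
  · have h := Subgroup.Normal.conj_mem ‹_› _ (inv_mem hu) (y₂ * y₀ * x₁)⁻¹
    convert h using 1
    group
  · have h := mul_mem (Subgroup.Normal.conj_mem ‹_› _ hu (x₀ * y₁)) h1
    convert h using 1
    group

/-- If a product of conjugates of the model generators, with the right multiplicities, is trivial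
up to some level, then the factors can be simultaneously conjugated into `constrained r n`. -/
theorem exists_conj_mem_constrained {r : ℕ} (hr : r ≠ 0) (n : ℕ) {L : List (ℕ × W)}
    (hL : Typed r L) (hc : ∀ k, k ≠ 0 → k ≤ n → indexCount k L = if k ≤ r then 2 else 1)
    (hp : listProd L ∈ stab (n + r)) :
    ∃ w : W, ∀ e ∈ L, w * e.2 * w⁻¹ ∈ constrained r n := by
  induction n generalizing L with
  | zero => exact ⟨1, fun _ _ => Subgroup.mem_top _⟩
  | succ n ih =>
    -- Hypotheses and conclusion are invariant under simultaneous conjugation, so the first factor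
    -- of index 1 may be taken to be `sigma`.
    suffices H : ∀ L₀ L' : List (ℕ × W), Typed r (L₀ ++ (1, sigma) :: L') →
        (∀ k, k ≠ 0 → k ≤ n + 1 →
          indexCount k (L₀ ++ (1, sigma) :: L') = if k ≤ r then 2 else 1) →
        indexCount 1 L₀ = 0 → listProd (L₀ ++ (1, sigma) :: L') ∈ stab (n + 1 + r) →
        ∃ w : W, ∀ e ∈ L₀ ++ (1, sigma) :: L', w * e.2 * w⁻¹ ∈ constrained r (n + 1) by
      have hc1 := hc 1 one_ne_zero (by omega)
      rw [if_pos (by omega)] at hc1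
      obtain ⟨L₀, s, L', rfl, hL₀⟩ := exists_eq_append_cons (k := 1) (L := L) (by omega)
      obtain ⟨c, rfl⟩ : ∃ c, c * sigma * c⁻¹ = s := isConj_iff.1 (hL (1, s) (by simp)).2
      have e : conjList c⁻¹ (L₀ ++ (1, c * sigma * c⁻¹) :: L') =
          conjList c⁻¹ L₀ ++ (1, sigma) :: conjList c⁻¹ L' := by
        simp [conjList, mul_assoc]
      obtain ⟨w, hw⟩ := H (conjList c⁻¹ L₀) (conjList c⁻¹ L') (e ▸ hL.conjList c⁻¹)
        (fun k hk hkn => by rw [← e, indexCount_conjList, hc k hk hkn])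
        (by rw [indexCount_conjList, hL₀])
        (by rw [← e, listProd_conjList]; exact Subgroup.Normal.conj_mem inferInstance _ hp _)
      refine ⟨w * c⁻¹, fun x hx => ?_⟩
      have := hw (x.1, c⁻¹ * x.2 * c⁻¹⁻¹) (by rw [← e]; exact List.mem_map.2 ⟨x, hx, rfl⟩)
      convert this using 1
      group
    clear hL hc hp L
    intro L₀ L' hL hc hL₀ hp
    have hc1 := hc 1 one_ne_zero (by omega)
    rw [if_pos (by omega), indexCount_append, indexCount_cons, if_pos rfl, hL₀] at hc1
    -- As `r ≥ 1`, there are exactly two factors of index 1: `sigma` and a second one, `s`, whose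
    -- sections are mutually inverse because `s` is an involution.
    obtain ⟨L₁, s, L₂, rfl, hL₁⟩ := exists_eq_append_cons (k := 1) (L := L') (by omega)
    rw [indexCount_append, indexCount_cons, if_pos rfl, hL₁] at hc1
    have hL₂ : indexCount 1 L₂ = 0 := by omega
    obtain ⟨X₀, Y₀, hX₀, hY₀, hs₀, hXp₀, hYp₀, hc₀, hS₀⟩ :=
      exists_sections (fun e he => hL e (by simp [he])) hL₀
    obtain ⟨X₁, Y₁, hX₁, hY₁, hs₁, hXp₁, hYp₁, hc₁, hS₁⟩ :=
      exists_sections (fun e he => hL e (by simp [he])) hL₁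
    obtain ⟨X₂, Y₂, hX₂, hY₂, hs₂, hXp₂, hYp₂, hc₂, hS₂⟩ :=
      exists_sections (fun e he => hL e (by simp [he])) hL₂
    have hconj : IsConj (model r 1) s := (hL (1, s) (by simp)).2
    have hss : swaps s = true := by
      rw [← act_eq_one_iff, ← sgn_one_left, ← sgn_eq_of_isConj 1 hconj]
      rfl
    have hinv : sec s true = (sec s false)⁻¹ := by
      have h2 : s * s = 1 := by
        obtain ⟨c, rfl⟩ := isConj_iff.1 hconj
        have : c * model r 1 * c⁻¹ * (c * model r 1 * c⁻¹) = c * (model r 1 * model r 1) * c⁻¹ := by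
          group
        rw [this, model_mul_self]; group
      have h3 := sec_mul s s false
      rw [h2, hss, sec_one] at h3
      exact eq_inv_of_mul_eq_one_left h3.symm
    set u := sec s false with hu
    rw [Nat.add_right_comm, mem_stab_succ] at hp
    obtain ⟨-, hp⟩ := hp
    have hpf := hp false
    have hpt := hp true
    simp only [listProd_append, listProd_cons, sec_mul, hs₁, hs₂, hss, swaps_sigma,
      sec_sigma, Bool.xor_false, Bool.xor_true, Bool.not_true, Bool.not_false, hXp₀, hYp₀,
      hXp₁, hYp₁, hXp₂, hYp₂, ← hu, hinv, mul_one, ← mul_assoc] at hpf hpt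
    -- The sections of the product at the two vertices give two relations modulo `stab (n + r)`.
    -- Eliminating `u` joins them into one relation, in the order of the list used next.
    obtain ⟨hu', hprod⟩ := mk_eq_of_mul_mem hpf hpt
    obtain ⟨w, hw⟩ := ih (L := X₀ ++ Y₁ ++ Y₂ ++ Y₀ ++ X₁ ++ X₂)
      (((((hX₀.append hY₁).append hY₂).append hY₀).append hX₁).append hX₂)
      -- The multiplicity of `k` is the old one of `k + 1`, except that it doubles at `k = r`,
      -- turning the single factor of index `r + 1` into the required two.
      (fun k hk hkn => by
        have h := hc (k + 1) (by omega) (by omega)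
        simp only [indexCount_append, indexCount_cons] at h ⊢
        rw [if_neg (show ¬ (1 = k + 1) by omega)] at h
        have h0 := hc₀ k hk
        have h1 := hc₁ k hk
        have h2 := hc₂ k hk
        split_ifs at * <;> omega)
      (by simpa only [listProd_append] using hprod)
    let S : Subgroup W := (constrained r n).comap (MulAut.conj w).toMonoidHom
    have hS : ∀ z, z ∈ S ↔ w * z * w⁻¹ ∈ constrained r n := fun z => Iff.rfl
    have hwS : ∀ e ∈ X₀ ++ Y₁ ++ Y₂ ++ Y₀ ++ X₁ ++ X₂, e.2 ∈ S := hw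
    -- Up to `stab (n + r)`, which lies in `constrained r n`, the section `u` is a product of
    -- factors already conjugated by `w`.
    have huS : u ∈ S := by
      have h1 : (listProd Y₂ * listProd Y₀ * listProd X₁)⁻¹ * u ∈ S :=
        stab_le_constrained r n (Subgroup.Normal.conj_mem inferInstance _ hu' w)
      have h2 : listProd Y₂ * listProd Y₀ * listProd X₁ ∈ S := by
        refine mul_mem (mul_mem ?_ ?_) ?_ <;>
          exact listProd_mem fun e he => hwS e (by simp [he])
      simpa only [mul_inv_cancel_left] using mul_mem h2 h1
    have hsecS : ∀ e ∈ L₀ ++ (1, sigma) :: (L₁ ++ (1, s) :: L₂), ∀ x, sec e.2 x ∈ S := by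
      intro e he x
      rcases List.mem_append.1 he with he | he
      · exact (hS₀ S (fun e he => hwS e (by simp [he])) (fun e he => hwS e (by simp [he])) e he).2 x
      rcases List.mem_cons.1 he with rfl | he
      · exact one_mem S
      rcases List.mem_append.1 he with he | he
      · exact (hS₁ S (fun e he => hwS e (by simp [he])) (fun e he => hwS e (by simp [he])) e he).2 x
      rcases List.mem_cons.1 he with rfl | he
      · cases x
        · exact huS
        · rw [hinv]; exact inv_mem huS
      · exact (hS₂ S (fun e he => hwS e (by simp [he])) (fun e he => hwS e (by simp [he])) e he).2 x
    exact ⟨pair w w, fun e he => conj_pair_mem_constrained (sgn_sections_of_isConj (hL e he).2)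
      fun x => hsecS e he x⟩

/-! ### Strong families are conjugate to generators of a constrained group -/

theorem isClosed_closedSubgroupGeneratedBy {I : Type*} (b : I → W) :
    IsClosed (closedSubgroupGeneratedBy b : Set W) :=
  Subgroup.isClosed_topologicalClosure _

theorem mem_closedSubgroupGeneratedBy {I : Type*} (b : I → W) (i : I) :
    b i ∈ closedSubgroupGeneratedBy b :=
  Subgroup.le_topologicalClosure _ (Subgroup.subset_closure ⟨i, rfl⟩)

theorem closedSubgroupGeneratedBy_le {I : Type*} {b : I → W} {H : Subgroup W}
    (hH : IsClosed (H : Set W)) (h : ∀ i, b i ∈ H) : closedSubgroupGeneratedBy b ≤ H :=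
  Subgroup.topologicalClosure_minimal _
    ((Subgroup.closure_le _).2 (by rintro _ ⟨i, rfl⟩; exact h i)) hH

theorem isClosed_setOf_conj_mem {H : Subgroup W} (hH : IsClosed (H : Set W)) (g : W) :
    IsClosed {w : W | w * g * w⁻¹ ∈ H} :=
  IsClosed.preimage (f := fun w : W => w * g * w⁻¹) (by fun_prop) hH

/-- A family of conjugates of the model generators, with the right multiplicities, whose product
in some order converges to `1`, can be simultaneously conjugated into `levelGroup r`. -/
theorem exists_conj_mem_levelGroup {r : ℕ} (hr : r ≠ 0) {I : Type*} {b : I → W} {τ : I → ℕ}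
    (hτ : ∀ i, τ i ≠ 0) (hb : ∀ i, IsConj (model r (τ i)) (b i))
    (hcard : ∀ k, k ≠ 0 → ∃ F : Finset I, (∀ i, i ∈ F ↔ τ i = k) ∧
      F.card = if k ≤ r then 2 else 1)
    (hp : ProductConvergesToOne b) : ∃ w : W, ∀ i, w * b i * w⁻¹ ∈ levelGroup r := by
  classical
  obtain ⟨_, hlim⟩ := hp
  have hF : ∀ k, ∃ F : Finset I, k ≠ 0 → (∀ i, i ∈ F ↔ τ i = k) ∧
      F.card = if k ≤ r then 2 else 1 := fun k => by
    by_cases hk : k = 0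
    · exact ⟨∅, fun h => absurd hk h⟩
    · obtain ⟨F, hF⟩ := hcard k hk
      exact ⟨F, fun _ => hF⟩
  choose F hF using hF
  have hfin : ∀ (s₀ : Finset I) (n : ℕ), ∃ w : W, ∀ i ∈ s₀, w * b i * w⁻¹ ∈ constrained r n := by
    intro s₀ n
    -- The finite set is chosen to contain `s₀` and all elements of index at most `n`, so that
    -- multiplicities are exact up to `n`. Elements of larger index may occur freely.
    have hev := hlim.eventually ((isOpen_stab (n + r)).mem_nhds (one_mem _))
    obtain ⟨s, hs, hss⟩ := (hev.and
      (eventually_ge_atTop (s₀ ∪ (Finset.Icc 1 n).biUnion F))).exists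
    have hcount : ∀ k, indexCount k ((s.sort (· ≤ ·)).map fun i => (τ i, b i)) =
        (s.filter fun i => k = τ i).card := fun k => by
      rw [indexCount, List.map_map, ← Multiset.coe_count, ← Multiset.map_coe, Finset.sort_eq,
        Multiset.count_map]
      rfl
    obtain ⟨w, hw⟩ := exists_conj_mem_constrained hr n
      (L := (s.sort (· ≤ ·)).map fun i => (τ i, b i))
      (fun e he => by
        obtain ⟨i, -, rfl⟩ := List.mem_map.1 he
        exact ⟨hτ i, hb i⟩)
      (fun k hk hkn => by
        rw [hcount, ← (hF k hk).2]
        congr 1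
        ext i
        rw [Finset.mem_filter, (hF k hk).1, eq_comm, and_iff_right_iff_imp]
        intro hi
        refine hss (Finset.mem_union_right _ (Finset.mem_biUnion.2 ⟨k, ?_, ?_⟩))
        · exact Finset.mem_Icc.2 ⟨by omega, hkn⟩
        · exact ((hF k hk).1 i).2 hi)
      (by rw [listProd, List.map_map]; exact hs)
    exact ⟨w, fun i hi => hw _ (List.mem_map.2 ⟨i,
      (Finset.mem_sort _).2 (hss (Finset.mem_union_left _ hi)), rfl⟩)⟩
  -- The conjugators suitable for one element and one level form a closed set; any finitely many of
  -- these sets meet by `hfin`, since `constrained r n` decreases in `n`.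
  obtain ⟨w, hw⟩ := CompactSpace.iInter_nonempty
    (t := fun q : I × ℕ => {w : W | w * b q.1 * w⁻¹ ∈ constrained r q.2})
    (fun q => isClosed_setOf_conj_mem (isClosed_constrained r q.2) _)
    (fun s => by
      obtain ⟨w, hw⟩ := hfin (s.image Prod.fst) (s.sup Prod.snd)
      refine ⟨w, Set.mem_iInter₂.2 fun q hq => ?_⟩
      exact constrained_anti r (Finset.le_sup (f := Prod.snd) hq)
        (hw q.1 (Finset.mem_image_of_mem _ hq)))
  exact ⟨w, fun i => mem_levelGroup.2 fun n => Set.mem_iInter.1 hw (i, n)⟩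

/-- Once conjugated into `levelGroup r`, a generator of index `k` has leading index `k`, and every
index occurs; so the triangular test applies. -/
theorem exists_map_conj_eq_levelGroup {r : ℕ} (hr : r ≠ 0) {I : Type*} {b : I → W} {τ : I → ℕ}
    (hτ : ∀ i, τ i ≠ 0) (hb : ∀ i, IsConj (model r (τ i)) (b i))
    (hcard : ∀ k, k ≠ 0 → ∃ F : Finset I, (∀ i, i ∈ F ↔ τ i = k) ∧
      F.card = if k ≤ r then 2 else 1)
    (hp : ProductConvergesToOne b) :
    ∃ w : W, (closedSubgroupGeneratedBy b).map (MulAut.conj w).toMonoidHom = levelGroup r := by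
  obtain ⟨w, hw⟩ := exists_conj_mem_levelGroup hr hτ hb hcard hp
  refine ⟨w, eq_levelGroup_of_leading ?_ ?_ fun k hk => ?_⟩
  · have : ((closedSubgroupGeneratedBy b).map (MulAut.conj w).toMonoidHom : Set W) =
        (fun x => w⁻¹ * x * w) ⁻¹' (closedSubgroupGeneratedBy b : Set W) := by
      ext x
      constructor
      · rintro ⟨y, hy, rfl⟩
        simpa [mul_assoc] using hy
      · intro hx
        exact ⟨_, hx, by simp [mul_assoc]⟩
    rw [this]
    exact (isClosed_closedSubgroupGeneratedBy b).preimage (by fun_prop)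
  · refine Subgroup.map_le_iff_le_comap.2 (closedSubgroupGeneratedBy_le ?_ hw)
    exact IsClosed.preimage (f := fun x : W => w * x * w⁻¹) (by fun_prop) (isClosed_levelGroup r)
  · obtain ⟨F, hF, hFc⟩ := hcard k hk
    obtain ⟨i, hi⟩ : F.Nonempty := by
      rw [← Finset.card_pos, hFc]
      split_ifs <;> omega
    have hbi := hb i
    rw [(hF i).1 hi] at hbi
    exact ⟨w * b i * w⁻¹, Subgroup.mem_map.2 ⟨b i, mem_closedSubgroupGeneratedBy b i, rfl⟩,
      chi_of_isConj_model r hk (hw i) (hbi.trans (isConj_iff.2 ⟨w, rfl⟩))⟩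

theorem exists_map_conj_eq_of_levelGroup {r : ℕ} {G G' : Subgroup W}
    (hG : ∃ w : W, G.map (MulAut.conj w).toMonoidHom = levelGroup r)
    (hG' : ∃ w : W, G'.map (MulAut.conj w).toMonoidHom = levelGroup r) :
    ∃ w : W, G' = G.map (MulAut.conj w).toMonoidHom := by
  obtain ⟨w, hw⟩ := hG
  obtain ⟨w', hw'⟩ := hG'
  refine ⟨w'⁻¹ * w, ?_⟩
  have h1 : (MulAut.conj (w'⁻¹ * w)).toMonoidHom =
      (MulAut.conj w'⁻¹).toMonoidHom.comp (MulAut.conj w).toMonoidHom := by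
    rw [map_mul]; rfl
  have h2 : (MulAut.conj w'⁻¹).toMonoidHom.comp (MulAut.conj w').toMonoidHom = MonoidHom.id W := by
    ext1 x
    simp [mul_assoc]
  rw [h1, ← Subgroup.map_map, hw, ← hw', Subgroup.map_map, h2, Subgroup.map_id]

/-! ### Sign power series -/

open PowerSeries in
/-- The generating function of the signs of `g` at all levels. -/
noncomputable def signSeries (g : W) : (ZMod 2)⟦X⟧ := PowerSeries.mk fun k => sgn (k + 1) g

theorem signSeries_mul (g h : W) : signSeries (g * h) = signSeries g + signSeries h := by
  ext k; simp [signSeries, sgn_mul]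

@[simp] theorem signSeries_one : signSeries 1 = 0 := by
  ext k; simp [signSeries]

theorem signSeries_inv (g : W) : signSeries g⁻¹ = -signSeries g :=
  eq_neg_of_add_eq_zero_left (by rw [← signSeries_mul, inv_mul_cancel, signSeries_one])

theorem signSeries_eq_of_isConj {g h : W} (H : IsConj g h) : signSeries g = signSeries h := by
  ext k; simp [signSeries, sgn_eq_of_isConj (k + 1) H]

theorem signSeries_pair (u v : W) :
    signSeries (pair u v) = PowerSeries.X * (signSeries u + signSeries v) := by
  ext k
  rcases k with _ | k
  · simp only [signSeries, PowerSeries.coeff_mk, PowerSeries.coeff_zero_X_mul]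
    exact act_eq_zero_iff.2 (by simp)
  · simp [signSeries, PowerSeries.coeff_succ_X_mul, sgn_succ_succ]

theorem signSeries_sigma : signSeries sigma = 1 := by
  ext k
  rcases k with _ | k
  · simp only [signSeries, PowerSeries.coeff_mk, PowerSeries.coeff_zero_one]
    exact act_eq_one_iff.2 rfl
  · simp [signSeries, sgn_succ_succ, PowerSeries.coeff_one]

/-- The sign series of the elements of `G`. -/
def signRange (G : Subgroup W) : AddSubgroup (PowerSeries (ZMod 2)) where
  carrier := signSeries '' G
  zero_mem' := ⟨1, one_mem G, signSeries_one⟩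
  add_mem' := by
    rintro _ _ ⟨g, hg, rfl⟩ ⟨h, hh, rfl⟩
    exact ⟨g * h, mul_mem hg hh, signSeries_mul g h⟩
  neg_mem' := by
    rintro _ ⟨g, hg, rfl⟩
    exact ⟨g⁻¹, inv_mem hg, signSeries_inv g⟩

/-- The triangular test with `r = 0`, where `chi 0 k` is `sgn k`. The coefficient of `X ^ k` is the
sign of index `k + 1`. -/
theorem eq_top_of_X_pow_mem {G : Subgroup W} (hG : IsClosed (G : Set W))
    (h : ∀ k : ℕ, (PowerSeries.X ^ k : PowerSeries (ZMod 2)) ∈ signRange G) : G = ⊤ := by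
  rw [← levelGroup_zero]
  refine eq_levelGroup_of_leading hG (by rw [levelGroup_zero]; exact le_top) fun k hk => ?_
  obtain ⟨k, rfl⟩ := Nat.exists_eq_succ_of_ne_zero hk
  obtain ⟨g, hg, hgk⟩ := h k
  have hs : ∀ j, sgn (j + 1) g = if j = k then 1 else 0 := fun j => by
    have := congrArg (PowerSeries.coeff j) hgk
    rwa [signSeries, PowerSeries.coeff_mk, PowerSeries.coeff_X_pow] at this
  refine ⟨g, hg, fun j hj => ?_, by rw [chi_zero_left, hs, if_pos rfl]⟩
  rw [chi_zero_left]
  rcases j with _ | j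
  · rfl
  · rw [hs, if_neg (by omega)]

/-- If `γ` is a sum of two monomials, then `X ^ (k - r) * γ` equals `X ^ k` plus a power with
smaller exponent, because `s < r`; strong induction removes the latter. -/
theorem X_pow_mem_of_shift {R : Type*} [CommRing R] {V : AddSubgroup (PowerSeries R)} {r s : ℕ}
    (hsr : s < r) {γ : PowerSeries R} (hV : ∀ i < r, PowerSeries.X ^ i ∈ V)
    (hγ : γ = PowerSeries.X ^ s ∨ γ = PowerSeries.X ^ r ∨
      γ = PowerSeries.X ^ s + PowerSeries.X ^ r)
    (hVγ : ∀ i, PowerSeries.X ^ i * γ ∈ V) (k : ℕ) : PowerSeries.X ^ k ∈ V := by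
  induction k using Nat.strong_induction_on with
  | _ k ih =>
    by_cases hk : k < r
    · exact hV k hk
    rcases hγ with rfl | rfl | rfl
    · have := hVγ (k - s)
      rwa [← pow_add, Nat.sub_add_cancel (by omega)] at this
    · have := hVγ (k - r)
      rwa [← pow_add, Nat.sub_add_cancel (by omega)] at this
    · have := hVγ (k - r)
      rw [mul_add, ← pow_add, ← pow_add, Nat.sub_add_cancel (by omega)] at this
      exact (AddSubgroup.add_mem_cancel_left V (ih _ (by omega))).1 this

/-! ### Relations in weak families -/

theorem mem_postcriticalOrbit {X : Type*} {f : X → X} {p q x : X} :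
    x ∈ postcriticalOrbit f {p, q} ↔ (∃ n, x = f^[n + 1] p) ∨ ∃ n, x = f^[n + 1] q := by
  simp only [postcriticalOrbit, Set.mem_iUnion, Set.image_pair, Set.mem_insert_iff,
    Set.mem_singleton_iff]
  constructor
  · rintro ⟨n, hn, h⟩
    obtain ⟨n, rfl⟩ := Nat.exists_eq_add_of_le' hn
    exact h.imp (fun h => ⟨n, h⟩) (fun h => ⟨n, h⟩)
  · rintro (⟨n, h⟩ | ⟨n, h⟩)
    · exact ⟨n + 1, by omega, Or.inl h⟩
    · exact ⟨n + 1, by omega, Or.inr h⟩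

/-- The element `f^(n+1) p` of the postcritical orbit. -/
def orbitLeft {X : Type*} (f : X → X) (p q : X) (n : ℕ) : postcriticalOrbit f {p, q} :=
  ⟨f^[n + 1] p, mem_postcriticalOrbit.2 (Or.inl ⟨n, rfl⟩)⟩

/-- The element `f^(n+1) q` of the postcritical orbit. -/
def orbitRight {X : Type*} (f : X → X) (p q : X) (n : ℕ) : postcriticalOrbit f {p, q} :=
  ⟨f^[n + 1] q, mem_postcriticalOrbit.2 (Or.inr ⟨n, rfl⟩)⟩

theorem apply_orbitLeft {X : Type*} (f : X → X) (p q : X) (n : ℕ) :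
    f (orbitLeft f p q n) = orbitLeft f p q (n + 1) :=
  (Function.iterate_succ_apply' f (n + 1) p).symm

theorem apply_orbitRight {X : Type*} (f : X → X) (p q : X) (n : ℕ) :
    f (orbitRight f p q n) = orbitRight f p q (n + 1) :=
  (Function.iterate_succ_apply' f (n + 1) q).symm

theorem eq_orbitLeft_or_eq_orbitRight {X : Type*} {f : X → X} {p q : X}
    (x : postcriticalOrbit f {p, q}) :
    (∃ n, x = orbitLeft f p q n) ∨ ∃ n, x = orbitRight f p q n :=
  (mem_postcriticalOrbit.1 x.2).imp (fun ⟨n, h⟩ => ⟨n, Subtype.ext h⟩)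
    (fun ⟨n, h⟩ => ⟨n, Subtype.ext h⟩)

namespace WeaklyOfType

variable {X : Type*} {f : X → X} {C : Set X} {b : postcriticalOrbit f C → W}

theorem isConj_sigma (hb : WeaklyOfType f C b) {x : postcriticalOrbit f C}
    (h : ∀ y : postcriticalOrbit f C, f y ≠ x) : IsConj (b x) sigma := by
  rcases hb x with ⟨c, -, -, -, hc⟩ | ⟨c, -, hc, -⟩ | ⟨q, -, hq, -⟩ | ⟨q, q', -, -, -, hq, -⟩
  · exact hc
  · exact absurd hc (h c)
  · exact absurd hq (h q)
  · exact absurd hq (h q)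

theorem isConj_pair_one (hb : WeaklyOfType f C b) {x y : postcriticalOrbit f C}
    (h : ∀ z : postcriticalOrbit f C, f z = x → z = y) (hC : ∀ c ∈ C, f c ≠ x) :
    IsConj (b x) (pair (b y) 1) := by
  rcases hb x with ⟨c, hc, -, hcx, -⟩ | ⟨c, hc, hcx, -⟩ | ⟨q, -, hq, -, hbq⟩ |
    ⟨q, q', hne, -, -, hq, hq', -⟩
  · exact absurd hcx (hC c hc)
  · exact absurd hcx (hC c hc)
  · rwa [← h q hq]
  · exact absurd ((h q hq).trans (h q' hq').symm) hne

theorem isConj_pair (hb : WeaklyOfType f C b) {x y y' : postcriticalOrbit f C}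
    (h : ∀ z : postcriticalOrbit f C, f z = x → z = y ∨ z = y') (hC : ∀ c ∈ C, f c ≠ x)
    (hy : f y = x) (hy' : f y' = x) (hyC : (y : X) ∉ C) (hyC' : (y' : X) ∉ C) (hyy : y ≠ y') :
    IsConj (b x) (pair (b y) (b y')) ∨ IsConj (b x) (pair (b y') (b y)) := by
  rcases hb x with ⟨c, hc, -, hcx, -⟩ | ⟨c, hc, hcx, -⟩ | ⟨q, -, -, hq, -⟩ |
    ⟨q, q', hne, -, -, hq, hq', hbq⟩
  · exact absurd hcx (hC c hc)
  · exact absurd hcx (hC c hc)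
  · exact absurd ((hq y hyC hy).trans (hq y' hyC' hy').symm) hyy
  · rcases h q hq with rfl | rfl <;> rcases h q' hq' with rfl | rfl
    · exact absurd rfl hne
    · exact Or.inl hbq
    · exact Or.inr hbq
    · exact absurd rfl hne

/-- Needed where a point of `P` may also be the image of a critical point: only one of the competing
relations is imposed, so every possibility must be allowed. -/
theorem signSeries_cases (hb : WeaklyOfType f C b) {x y : postcriticalOrbit f C}
    (h : ∀ z : postcriticalOrbit f C, f z = x → z = y) :
    signSeries (b x) = 1 ∨ signSeries (b x) = PowerSeries.X * signSeries (b y) ∨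
      signSeries (b x) = 1 + PowerSeries.X * signSeries (b y) := by
  rcases hb x with ⟨c, -, -, -, hc⟩ | ⟨c, -, hcx, hc⟩ | ⟨q, -, hq, -, hbq⟩ |
    ⟨q, q', hne, -, -, hq, hq', -⟩
  · exact Or.inl (by rw [signSeries_eq_of_isConj hc, signSeries_sigma])
  · refine Or.inr (Or.inr ?_)
    rw [signSeries_eq_of_isConj hc, signSeries_mul, signSeries_pair, signSeries_one,
      signSeries_sigma, h c hcx, add_zero, add_comm]
  · refine Or.inr (Or.inl ?_)
    rw [signSeries_eq_of_isConj hbq, signSeries_pair, signSeries_one, h q hq, add_zero]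
  · exact absurd ((h q hq).trans (h q' hq').symm) hne

end WeaklyOfType

theorem signSeries_mem_signRange {I : Type*} (b : I → W) (i : I) :
    signSeries (b i) ∈ signRange (closedSubgroupGeneratedBy b) :=
  ⟨b i, mem_closedSubgroupGeneratedBy b i, rfl⟩

/-! ### The case of disjoint orbits -/

/-- The orbit of `p` alone suffices: its first point has no preimage in `P` and each later one has
exactly one, so the sign series are the successive powers of `X`. -/
theorem eq_top_of_disjoint_orbits {X : Type*} {f : X → X} {p q : X}
    (hinj : Set.InjOn (fun n => f^[n] p) (Set.Ici 1))
    (hd : ∀ m n, f^[m + 1] p ≠ f^[n + 1] q) {G : Subgroup W}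
    (hG : GroupWeaklyOfType f {p, q} G) : G = ⊤ := by
  obtain ⟨b, hb, rfl⟩ := hG
  have hP : ∀ {m n}, f^[m + 1] p = f^[n + 1] p → m = n := fun {m n} h => by
    have := hinj (show 1 ≤ m + 1 by omega) (show 1 ≤ n + 1 by omega) h
    omega
  have hpre : ∀ (z : postcriticalOrbit f {p, q}) (n : ℕ), f z = orbitLeft f p q n →
      ∃ m, n = m + 1 ∧ z = orbitLeft f p q m := by
    intro z n hz
    rcases eq_orbitLeft_or_eq_orbitRight z with ⟨m, rfl⟩ | ⟨m, rfl⟩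
    · rw [apply_orbitLeft f] at hz
      exact ⟨m, (hP hz).symm, rfl⟩
    · rw [apply_orbitRight f] at hz
      exact absurd hz.symm (hd _ _)
  have hs : ∀ n, signSeries (b (orbitLeft f p q n)) = PowerSeries.X ^ n := by
    intro n
    induction n with
    | zero =>
      rw [pow_zero, ← signSeries_sigma]
      refine signSeries_eq_of_isConj (hb.isConj_sigma fun z hz => ?_)
      obtain ⟨m, hm, -⟩ := hpre z 0 hz
      omega
    | succ n ih =>
      rw [signSeries_eq_of_isConj (hb.isConj_pair_one (y := orbitLeft f p q n) ?_ ?_),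
        signSeries_pair, ih, signSeries_one, add_zero, pow_succ']
      · intro z hz
        obtain ⟨m, hm, rfl⟩ := hpre z _ hz
        rw [Nat.succ_injective hm]
      · rintro c (rfl | rfl) hc
        · have := hP (m := 0) (n := n + 1) hc
          omega
        · exact hd _ 0 hc.symm
  exact eq_top_of_X_pow_mem (isClosed_closedSubgroupGeneratedBy b) fun k =>
    hs k ▸ signSeries_mem_signRange b _

theorem CaseB.exists_le {X : Type*} {f : X → X} {p q : X} {r s : ℕ} (h : CaseB f p q r s) (n : ℕ) :
    ∃ j < r, f^[n + 1] q = f^[j + 1] q := by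
  obtain ⟨hsr, -, hq⟩ := h
  induction n with
  | zero => exact ⟨0, by omega, rfl⟩
  | succ n ih =>
    obtain ⟨j, hj, e⟩ := ih
    have e' : f^[n + 1 + 1] q = f^[j + 1 + 1] q := by
      rw [Function.iterate_succ_apply' f, e, ← Function.iterate_succ_apply' f]
    by_cases hjr : j + 1 < r
    · exact ⟨j + 1, hjr, e'⟩
    · obtain rfl : r = j + 1 := by omega
      exact ⟨s, hsr, e'.trans hq⟩

theorem eq_top_of_caseA {X : Type*} {f : X → X} {p q : X} (h : CaseA f p q) {G : Subgroup W}
    (hG : GroupWeaklyOfType f {p, q} G) : G = ⊤ :=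
  eq_top_of_disjoint_orbits h.1
    (fun m n => h.2.2 _ (Nat.le_add_left 1 m) _ (Nat.le_add_left 1 n)) hG

theorem eq_top_of_caseB {X : Type*} {f : X → X} {p q : X} {r s : ℕ} (h : CaseB f p q r s)
    {G : Subgroup W} (hG : GroupWeaklyOfType f {p, q} G) : G = ⊤ :=
  eq_top_of_disjoint_orbits h.2.1.1 (fun m n e => by
    obtain ⟨j, hj, hq⟩ := h.exists_le n
    exact h.2.1.2.2 _ (Nat.le_add_left 1 m) _ ⟨Nat.le_add_left 1 j, hj⟩ (e.trans hq)) hG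

/-! ### The case of merging orbits -/

namespace CaseC

variable {X : Type*} {f : X → X} {p q : X} {r s : ℕ}

theorem left_inj (h : CaseC f p q r s) {m n : ℕ} (e : f^[m + 1] p = f^[n + 1] p) : m = n := by
  have := h.2.1.1 (Nat.le_add_left 1 m) (Nat.le_add_left 1 n) e
  omega

theorem right_inj (h : CaseC f p q r s) {m n : ℕ} (hm : m < s) (hn : n < s)
    (e : f^[m + 1] q = f^[n + 1] q) : m = n := by
  have := h.2.1.2.1 ⟨Nat.le_add_left 1 m, hm⟩ ⟨Nat.le_add_left 1 n, hn⟩ e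
  omega

theorem left_ne_right (h : CaseC f p q r s) (m : ℕ) {n : ℕ} (hn : n < s) :
    f^[m + 1] p ≠ f^[n + 1] q :=
  h.2.1.2.2 _ (Nat.le_add_left 1 m) _ ⟨Nat.le_add_left 1 n, hn⟩

theorem right_add (h : CaseC f p q r s) (k : ℕ) : f^[s + k + 1] q = f^[r + k + 1] p := by
  rw [Nat.add_right_comm, Nat.add_comm, Function.iterate_add_apply, ← h.2.2,
    ← Function.iterate_add_apply, Nat.add_comm k, Nat.add_right_comm]

theorem eq_left_or_right (h : CaseC f p q r s) (x : postcriticalOrbit f {p, q}) :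
    (∃ n, x = orbitLeft f p q n) ∨ ∃ n < s, x = orbitRight f p q n := by
  rcases eq_orbitLeft_or_eq_orbitRight x with h' | ⟨n, rfl⟩
  · exact Or.inl h'
  · by_cases hn : n < s
    · exact Or.inr ⟨n, hn, rfl⟩
    · obtain ⟨k, rfl⟩ := Nat.exists_eq_add_of_le (not_lt.1 hn)
      exact Or.inl ⟨r + k, Subtype.ext (h.right_add k)⟩

/-- Preimages within the postcritical orbit of the points of the first orbit. -/
theorem preimage_left (h : CaseC f p q r s) {z : postcriticalOrbit f {p, q}} {n : ℕ}
    (hz : f z = orbitLeft f p q n) : (∃ m, n = m + 1 ∧ z = orbitLeft f p q m) ∨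
      ∃ m, s = m + 1 ∧ n = r ∧ z = orbitRight f p q m := by
  rcases h.eq_left_or_right z with ⟨m, rfl⟩ | ⟨m, hm, rfl⟩
  · rw [apply_orbitLeft f] at hz
    exact Or.inl ⟨m, (h.left_inj hz).symm, rfl⟩
  · rw [apply_orbitRight f] at hz
    by_cases hms : m + 1 < s
    · exact absurd hz.symm (h.left_ne_right n hms)
    · obtain rfl : s = m + 1 := by omega
      exact Or.inr ⟨m, rfl, (h.left_inj (h.2.2.trans hz)).symm, rfl⟩

/-- Preimages within the postcritical orbit of the points of the second orbit before the merger. -/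
theorem preimage_right (h : CaseC f p q r s) {z : postcriticalOrbit f {p, q}} {n : ℕ} (hn : n < s)
    (hz : f z = orbitRight f p q n) : ∃ m, n = m + 1 ∧ z = orbitRight f p q m := by
  rcases h.eq_left_or_right z with ⟨m, rfl⟩ | ⟨m, hm, rfl⟩
  · rw [apply_orbitLeft f] at hz
    exact absurd hz (h.left_ne_right _ hn)
  · rw [apply_orbitRight f] at hz
    by_cases hms : m + 1 < s
    · exact ⟨m, (h.right_inj hms hn hz).symm, rfl⟩
    · obtain rfl : s = m + 1 := by omega
      exact absurd (h.2.2.trans hz) (h.left_ne_right _ hn)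

theorem apply_critical_ne_left (h : CaseC f p q r s) {n : ℕ} (hn : n ≠ 0) (hns : s ≠ 0 ∨ n ≠ r) :
    ∀ c ∈ ({p, q} : Set X), f c ≠ orbitLeft f p q n := by
  rintro c (rfl | rfl) e
  · exact hn (h.left_inj (m := 0) e).symm
  · by_cases hs : s = 0
    · subst hs
      exact hns.resolve_left (fun h => h rfl) (h.left_inj (h.2.2.trans e)).symm
    · exact h.left_ne_right n (Nat.pos_of_ne_zero hs) (n := 0) e.symm

theorem isConj_left_zero (h : CaseC f p q r s) (hr : r ≠ 0) {b : postcriticalOrbit f {p, q} → W}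
    (hb : WeaklyOfType f {p, q} b) : IsConj (b (orbitLeft f p q 0)) sigma :=
  hb.isConj_sigma fun z hz => by
    rcases h.preimage_left hz with ⟨m, hm, -⟩ | ⟨m, -, hm, -⟩ <;> omega

theorem isConj_left_succ (h : CaseC f p q r s) {b : postcriticalOrbit f {p, q} → W}
    (hb : WeaklyOfType f {p, q} b) {n : ℕ} (hn : n + 1 ≠ r) :
    IsConj (b (orbitLeft f p q (n + 1))) (pair (b (orbitLeft f p q n)) 1) := by
  refine hb.isConj_pair_one (fun z hz => ?_) (h.apply_critical_ne_left (by omega) (Or.inr hn))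
  rcases h.preimage_left hz with ⟨m, hm, rfl⟩ | ⟨m, -, hm, -⟩
  · rw [Nat.succ_injective hm]
  · omega

theorem isConj_right_zero (h : CaseC f p q r s) (hs : s ≠ 0) {b : postcriticalOrbit f {p, q} → W}
    (hb : WeaklyOfType f {p, q} b) : IsConj (b (orbitRight f p q 0)) sigma :=
  hb.isConj_sigma fun z hz => by
    obtain ⟨m, hm, -⟩ := h.preimage_right (Nat.pos_of_ne_zero hs) hz
    omega

theorem isConj_right_succ (h : CaseC f p q r s) {b : postcriticalOrbit f {p, q} → W}
    (hb : WeaklyOfType f {p, q} b) {n : ℕ} (hn : n + 1 < s) :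
    IsConj (b (orbitRight f p q (n + 1))) (pair (b (orbitRight f p q n)) 1) := by
  refine hb.isConj_pair_one (fun z hz => ?_) ?_
  · obtain ⟨m, hm, rfl⟩ := h.preimage_right hn hz
    rw [Nat.succ_injective hm]
  · rintro c (rfl | rfl) e
    · exact h.left_ne_right 0 hn e
    · have := h.right_inj (m := 0) (by omega) hn e
      omega

theorem isConj_merge (h : CaseC f p q (r + 1) (s + 1)) {b : postcriticalOrbit f {p, q} → W}
    (hb : WeaklyOfType f {p, q} b) :
    IsConj (b (orbitLeft f p q (r + 1))) (pair (b (orbitLeft f p q r)) (b (orbitRight f p q s))) ∨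
    IsConj (b (orbitLeft f p q (r + 1))) (pair (b (orbitRight f p q s)) (b (orbitLeft f p q r))) := by
  have hC := h.apply_critical_ne_left (n := r + 1) (by omega) (Or.inl (by omega))
  have hy := apply_orbitLeft f p q r
  have hy' : f (orbitRight f p q s) = orbitLeft f p q (r + 1) := by
    rw [apply_orbitRight f]
    exact h.2.2.symm
  refine hb.isConj_pair (fun z hz => ?_) hC hy hy' (fun hc => hC _ hc hy) (fun hc => hC _ hc hy')
    fun e => h.left_ne_right r (Nat.lt_succ_self s) (congrArg Subtype.val e)
  rcases h.preimage_left hz with ⟨m, hm, rfl⟩ | ⟨m, hm, -, rfl⟩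
  · exact Or.inl (by rw [Nat.succ_injective hm])
  · exact Or.inr (by rw [Nat.succ_injective hm])

/-- Beyond the merger the second orbit is a tail of the first, so it is infinite too, and the roles
of the orbits can be exchanged. -/
theorem symm (h : CaseC f p q r s) : CaseC f q p s r := by
  have hq : ∀ n, (∃ k, n = s + k ∧ f^[n + 1] q = f^[r + k + 1] p) ∨ n < s := fun n => by
    by_cases hn : n < s
    · exact Or.inr hn
    · obtain ⟨k, rfl⟩ := Nat.exists_eq_add_of_le (not_lt.1 hn)
      exact Or.inl ⟨k, rfl, h.right_add k⟩
  refine ⟨fun h' => h.1 h'.symm, ⟨?_, ?_, ?_⟩, h.2.2.symm⟩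
  · rintro m (hm : 1 ≤ m) n (hn : 1 ≤ n) (e : f^[m] q = f^[n] q)
    obtain ⟨m, rfl⟩ := Nat.exists_eq_add_of_le' hm
    obtain ⟨n, rfl⟩ := Nat.exists_eq_add_of_le' hn
    rcases hq m with ⟨k, rfl, hk⟩ | hm <;> rcases hq n with ⟨l, rfl, hl⟩ | hn
    · have := h.left_inj (hk.symm.trans (e.trans hl))
      omega
    · exact absurd (hk.symm.trans e) (h.left_ne_right _ hn)
    · exact absurd (hl.symm.trans e.symm) (h.left_ne_right _ hm)
    · rw [h.right_inj hm hn e]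
  · exact h.2.1.1.mono fun n hn => hn.1
  · rintro m (hm : 1 ≤ m) n ⟨hn, hnr⟩ e
    obtain ⟨m, rfl⟩ := Nat.exists_eq_add_of_le' hm
    obtain ⟨n, rfl⟩ := Nat.exists_eq_add_of_le' hn
    rcases hq m with ⟨k, rfl, hk⟩ | hm
    · have := h.left_inj (hk.symm.trans e)
      omega
    · exact h.left_ne_right _ hm e.symm

theorem eq_top_of_lt (h : CaseC f p q r s) (hsr : s < r) {G : Subgroup W}
    (hG : GroupWeaklyOfType f {p, q} G) : G = ⊤ := by
  obtain ⟨b, hb, rfl⟩ := hG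
  have hr : r ≠ 0 := by omega
  have hleft : ∀ n < r, signSeries (b (orbitLeft f p q n)) = PowerSeries.X ^ n := by
    intro n hn
    induction n with
    | zero =>
      rw [signSeries_eq_of_isConj (h.isConj_left_zero hr hb), signSeries_sigma, pow_zero]
    | succ n ih =>
      rw [signSeries_eq_of_isConj (h.isConj_left_succ hb hn.ne), signSeries_pair, ih (by omega),
        signSeries_one, add_zero, pow_succ']
  have hright : ∀ n < s, signSeries (b (orbitRight f p q n)) = PowerSeries.X ^ n := by
    intro n hn
    induction n with
    | zero =>
      rw [signSeries_eq_of_isConj (h.isConj_right_zero (by omega) hb), signSeries_sigma, pow_zero]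
    | succ n ih =>
      rw [signSeries_eq_of_isConj (h.isConj_right_succ hb hn), signSeries_pair, ih (by omega),
        signSeries_one, add_zero, pow_succ']
  have htail : ∀ i, signSeries (b (orbitLeft f p q (r + i))) =
      PowerSeries.X ^ i * signSeries (b (orbitLeft f p q r)) := by
    intro i
    induction i with
    | zero => simp
    | succ i ih =>
      rw [← add_assoc, signSeries_eq_of_isConj (h.isConj_left_succ hb (by omega)),
        signSeries_pair, ih, signSeries_one, add_zero, pow_succ', mul_assoc]
  refine eq_top_of_X_pow_mem (isClosed_closedSubgroupGeneratedBy b)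
    (X_pow_mem_of_shift hsr (fun i hi => hleft i hi ▸ signSeries_mem_signRange b _) ?_
      fun i => htail i ▸ signSeries_mem_signRange b _)
  obtain ⟨r, rfl⟩ := Nat.exists_eq_succ_of_ne_zero hr
  -- For `s = 0` the merging point is `f q`, so a critical relation may replace the orbit relation.
  -- For `s > 0` it is the image of two distinct noncritical points of `P`.
  rcases s with _ | s
  · have hc := hb.signSeries_cases (x := orbitLeft f p q (r + 1)) (y := orbitLeft f p q r)
      fun z hz => by
        rcases h.preimage_left hz with ⟨m, hm, rfl⟩ | ⟨m, hm, -, -⟩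
        · rw [Nat.succ_injective hm]
        · omega
    rwa [hleft r (by omega), ← pow_succ'] at hc
  · refine Or.inr (Or.inr ?_)
    rcases h.isConj_merge hb with hc | hc <;>
      rw [signSeries_eq_of_isConj hc, signSeries_pair, hleft r (by omega), hright s (by omega),
        Nat.succ_eq_add_one] <;>
      ring

theorem eq_top_of_ne (h : CaseC f p q r s) (hsr : r ≠ s) {G : Subgroup W}
    (hG : GroupWeaklyOfType f {p, q} G) : G = ⊤ := by
  rcases lt_or_gt_of_ne hsr with h' | h'
  · rw [Set.pair_comm] at hG
    exact h.symm.eq_top_of_lt h' hG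
  · exact h.eq_top_of_lt h' hG

end CaseC

/-! ### Orbits that merge after equally many steps -/

theorem _root_.IsConj.binTree_pair {u u' v v' : W} (hu : IsConj u u') (hv : IsConj v v') :
    IsConj (pair u v) (pair u' v') := by
  obtain ⟨c, rfl⟩ := isConj_iff.1 hu
  obtain ⟨d, rfl⟩ := isConj_iff.1 hv
  exact isConj_iff.2 ⟨pair c d, by rw [pair_inv, pair_mul, pair_mul]⟩

namespace CaseC

variable {X : Type*} {f : X → X} {p q : X} {r : ℕ}

theorem isConj_model_right (h : CaseC f p q r r) {b : postcriticalOrbit f {p, q} → W}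
    (hb : WeaklyOfType f {p, q} b) {n : ℕ} (hn : n < r) :
    IsConj (model r (n + 1)) (b (orbitRight f p q n)) := by
  induction n with
  | zero => exact (h.isConj_right_zero (by omega) hb).symm
  | succ n ih =>
    refine IsConj.trans ?_ (h.isConj_right_succ hb hn).symm
    rw [model_succ (by omega), if_neg (by omega)]
    exact (ih (by omega)).binTree_pair (IsConj.refl 1)

theorem isConj_model_left (h : CaseC f p q r r) {b : postcriticalOrbit f {p, q} → W}
    (hb : WeaklyOfType f {p, q} b) (n : ℕ) :
    IsConj (model r (n + 1)) (b (orbitLeft f p q n)) := by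
  have hr : r ≠ 0 := fun hr => h.1 ⟨hr, hr⟩
  induction n with
  | zero => exact (h.isConj_left_zero hr hb).symm
  | succ n ih =>
    rw [model_succ (by omega)]
    by_cases hn : n + 1 = r
    · subst hn
      rw [if_pos rfl]
      have hr := h.isConj_model_right hb (Nat.lt_succ_self n)
      rcases h.isConj_merge hb with hc | hc
      · exact (ih.binTree_pair hr).trans hc.symm
      · exact (hr.binTree_pair ih).trans hc.symm
    · rw [if_neg hn]
      exact (ih.binTree_pair (IsConj.refl 1)).trans (h.isConj_left_succ hb hn).symm

theorem exists_map_conj_eq_levelGroup (h : CaseC f p q r r) {G : Subgroup W}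
    (hG : GroupStronglyOfType f {p, q} G) :
    ∃ w : W, G.map (MulAut.conj w).toMonoidHom = levelGroup r := by
  classical
  obtain ⟨b, ⟨hb, hp⟩, rfl⟩ := hG
  have hr : r ≠ 0 := fun hr => h.1 ⟨hr, hr⟩
  have hidx : ∀ x : postcriticalOrbit f {p, q}, ∃ n, IsConj (model r (n + 1)) (b x) ∧
      (x = orbitLeft f p q n ∨ n < r ∧ x = orbitRight f p q n) := fun x => by
    rcases h.eq_left_or_right x with ⟨n, rfl⟩ | ⟨n, hn, rfl⟩
    · exact ⟨n, h.isConj_model_left hb n, Or.inl rfl⟩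
    · exact ⟨n, h.isConj_model_right hb hn, Or.inr ⟨hn, rfl⟩⟩
  choose τ hτ hτx using hidx
  have hleft : ∀ n, τ (orbitLeft f p q n) = n := fun n => by
    rcases hτx (orbitLeft f p q n) with e | ⟨hn, e⟩
    · exact (h.left_inj (congrArg Subtype.val e)).symm
    · exact absurd (congrArg Subtype.val e) (h.left_ne_right _ hn)
  have hright : ∀ n < r, τ (orbitRight f p q n) = n := fun n hn => by
    rcases hτx (orbitRight f p q n) with e | ⟨hn', e⟩
    · exact absurd (congrArg Subtype.val e).symm (h.left_ne_right _ hn)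
    · exact (h.right_inj hn hn' (congrArg Subtype.val e)).symm
  -- The shift by one arises because `orbitLeft` and `orbitRight` are numbered from 0 and the models
  -- from 1.
  refine BinTree.exists_map_conj_eq_levelGroup hr (τ := fun x => τ x + 1) (fun x => by omega) hτ
    (fun k hk => ?_) hp
  obtain ⟨k, rfl⟩ := Nat.exists_eq_succ_of_ne_zero hk
  by_cases hkr : k < r
  · refine ⟨{orbitLeft f p q k, orbitRight f p q k}, fun x => ?_, ?_⟩
    · rw [Finset.mem_insert, Finset.mem_singleton]
      constructor
      · rintro (rfl | rfl)
        · rw [hleft]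
        · rw [hright k hkr]
      · intro hx
        rw [← Nat.succ_injective hx]
        exact (hτx x).imp id And.right
    · rw [Finset.card_pair, if_pos (by omega)]
      exact fun e => h.left_ne_right k hkr (congrArg Subtype.val e)
  · refine ⟨{orbitLeft f p q k}, fun x => ?_, ?_⟩
    · rw [Finset.mem_singleton]
      constructor
      · rintro rfl
        rw [hleft]
      · intro hx
        have hx' : τ x = k := Nat.succ_injective hx
        rw [← hx']
        exact (hτx x).resolve_right fun hn => by omega
    · rw [Finset.card_singleton, if_neg (by omega)]

end CaseC

/-! ### Classification of the infinite postcritical orbits -/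

theorem injOn_iterate_of_infinite {X : Type*} {f : X → X} {p : X}
    (h : (Set.range fun n => f^[n + 1] p).Infinite) :
    Set.InjOn (fun n => f^[n] p) (Set.Ici 1) := by
  have key : ∀ a b, a < b → f^[a] p ≠ f^[b] p := by
    intro a b hab e
    have hn : ∀ n, ∃ j < b, f^[n] p = f^[j] p := by
      intro n
      induction n using Nat.strong_induction_on with
      | _ n ih =>
        by_cases hn : n < b
        · exact ⟨n, hn, rfl⟩
        · obtain ⟨k, rfl⟩ := Nat.exists_eq_add_of_le' (not_lt.1 hn)
          obtain ⟨j, hj, hk⟩ := ih (k + a) (by omega)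
          refine ⟨j, hj, ?_⟩
          rw [Function.iterate_add_apply, ← e, ← Function.iterate_add_apply, hk]
    refine h (((Set.finite_Iio b).image fun j => f^[j] p).subset ?_)
    rintro _ ⟨n, rfl⟩
    obtain ⟨j, hj, hnj⟩ := hn (n + 1)
    exact ⟨j, hj, hnj.symm⟩
  intro a _ b _ e
  rcases lt_trichotomy a b with h | h | h
  · exact absurd e (key a b h)
  · exact h
  · exact absurd e.symm (key b a h)

/-- If the orbits meet, the least index at which the second orbit enters the first gives case (c),
and `f p ≠ f q` excludes `r = s = 0`. If they do not meet, the first repetition in the second orbit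
gives case (b), and its absence case (a). -/
theorem cases_of_infinite_left {X : Type*} {f : X → X} {p q : X} (hf : f p ≠ f q)
    (h : (Set.range fun n => f^[n + 1] p).Infinite) :
    CaseA f p q ∨ (∃ r s, CaseB f p q r s) ∨ ∃ r s, CaseC f p q r s := by
  classical
  have hinj := injOn_iterate_of_infinite h
  by_cases hm : ∃ s r, f^[r + 1] p = f^[s + 1] q
  · obtain ⟨r, hr⟩ := Nat.find_spec hm
    set s := Nat.find hm with hs
    have hmin : ∀ m n, n < s → f^[m + 1] p ≠ f^[n + 1] q := fun m n hn e =>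
      Nat.find_min hm hn ⟨m, e⟩
    refine Or.inr (Or.inr ⟨r, s, ?_, ⟨hinj, ?_, ?_⟩, hr⟩)
    · rintro ⟨h1, h2⟩
      rw [h1, h2] at hr
      exact hf hr
    · have key : ∀ a b, 1 ≤ a → a < b → b ≤ s → f^[a] q ≠ f^[b] q := by
        intro a b ha hab hb e
        -- A repetition before the entry point can be cut out, which would make the second orbit
        -- enter the first `b - a` steps earlier.
        refine hmin r (s - b + a) (by omega) ?_
        have e1 : s - b + a + 1 = (s + 1 - b) + a := by omega
        rw [hr, e1, Function.iterate_add_apply f (s + 1 - b), e, ← Function.iterate_add_apply,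
          Nat.sub_add_cancel (by omega)]
      rintro a ⟨ha, ha'⟩ b ⟨hb, hb'⟩ e
      rcases lt_trichotomy a b with h | h | h
      · exact absurd e (key a b ha h hb')
      · exact h
      · exact absurd e.symm (key b a hb h ha')
    · rintro m (hm : 1 ≤ m) n ⟨hn, hn'⟩
      obtain ⟨m, rfl⟩ := Nat.exists_eq_add_of_le' hm
      obtain ⟨n, rfl⟩ := Nat.exists_eq_add_of_le' hn
      exact hmin m n hn'
  push Not at hm
  have hd : ∀ m, 1 ≤ m → ∀ n, 1 ≤ n → f^[m] p ≠ f^[n] q := by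
    intro m hm' n hn
    obtain ⟨m, rfl⟩ := Nat.exists_eq_add_of_le' hm'
    obtain ⟨n, rfl⟩ := Nat.exists_eq_add_of_le' hn
    exact hm n m
  by_cases hB : ∃ r s, s < r ∧ f^[r + 1] q = f^[s + 1] q
  · obtain ⟨s, hsr, e⟩ := Nat.find_spec hB
    refine Or.inr (Or.inl ⟨Nat.find hB, s, hsr, ⟨hinj, ?_, fun m hm n hn => hd m hm n hn.1⟩, e⟩)
    have key : ∀ a b, 1 ≤ a → a < b → b ≤ Nat.find hB → f^[a] q ≠ f^[b] q := by
      intro a b ha hab hb e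
      obtain ⟨a, rfl⟩ := Nat.exists_eq_add_of_le' ha
      obtain ⟨b, rfl⟩ := Nat.exists_eq_add_of_le' (ha.trans hab.le)
      exact Nat.find_min hB hb ⟨a, by omega, e.symm⟩
    rintro a ⟨ha, ha'⟩ b ⟨hb, hb'⟩ e
    rcases lt_trichotomy a b with h | h | h
    · exact absurd e (key a b ha h hb')
    · exact h
    · exact absurd e.symm (key b a hb h ha')
  · refine Or.inl ⟨hinj, ?_, fun m hm n hn => hd m hm n hn⟩
    have key : ∀ a b, 1 ≤ a → a < b → f^[a] q ≠ f^[b] q := by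
      intro a b ha hab e
      obtain ⟨a, rfl⟩ := Nat.exists_eq_add_of_le' ha
      obtain ⟨b, rfl⟩ := Nat.exists_eq_add_of_le' (ha.trans hab.le)
      exact hB ⟨b, a, by omega, e.symm⟩
    rintro a ha b hb e
    rcases lt_trichotomy a b with h | h | h
    · exact absurd e (key a b ha h)
    · exact h
    · exact absurd e.symm (key b a hb h)

theorem CaseA.symm {X : Type*} {f : X → X} {p q : X} (h : CaseA f p q) : CaseA f q p :=
  ⟨h.2.1, h.1, fun m hm n hn e => h.2.2 n hn m hm e.symm⟩

theorem cases_of_infinite {X : Type*} {f : X → X} {p q : X} (hf : f p ≠ f q)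
    (h : (postcriticalOrbit f {p, q}).Infinite) :
    CaseA f p q ∨ (∃ r s, CaseB f p q r s) ∨ (∃ r s, CaseB f q p r s) ∨
      ∃ r s, CaseC f p q r s := by
  have hun : postcriticalOrbit f {p, q} ⊆
      (Set.range fun n => f^[n + 1] p) ∪ Set.range fun n => f^[n + 1] q := by
    intro x hx
    exact (mem_postcriticalOrbit.1 hx).imp (fun ⟨n, h⟩ => ⟨n, h.symm⟩) (fun ⟨n, h⟩ => ⟨n, h.symm⟩)
  rcases Set.infinite_union.1 (h.mono hun) with hp | hq
  · rcases cases_of_infinite_left hf hp with h | h | h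
    · exact Or.inl h
    · exact Or.inr (Or.inl h)
    · exact Or.inr (Or.inr (Or.inr h))
  · rcases cases_of_infinite_left hf.symm hq with h | h | ⟨r, s, h⟩
    · exact Or.inl h.symm
    · exact Or.inr (Or.inr (Or.inl h))
    · exact Or.inr (Or.inr (Or.inr ⟨s, r, h.symm⟩))

theorem eq_top_of_cases {X : Type*} {f : X → X} {p q : X}
    (h : CaseA f p q ∨ (∃ r s, CaseB f p q r s) ∨ (∃ r s, CaseB f q p r s) ∨
      ∃ r s, CaseC f p q r s ∧ r ≠ s) {G : Subgroup W} (hG : GroupWeaklyOfType f {p, q} G) :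
    G = ⊤ := by
  rcases h with h | ⟨r, s, h⟩ | ⟨r, s, h⟩ | ⟨r, s, h, hrs⟩
  · exact eq_top_of_caseA h hG
  · exact eq_top_of_caseB h hG
  · rw [Set.pair_comm] at hG
    exact eq_top_of_caseB h hG
  · exact h.eq_top_of_ne hrs hG

theorem GroupStronglyOfType.weakly {X : Type*} {f : X → X} {C : Set X} {G : Subgroup W}
    (hG : GroupStronglyOfType f C G) : GroupWeaklyOfType f C G :=
  let ⟨b, hb, hGb⟩ := hG
  ⟨b, hb.1, hGb⟩

end BinTree

theorem theorem4p1p5 {X : Type*} (f : X → X) (p₀ q₀ : X) (hne : p₀ ≠ q₀) (hf : f p₀ ≠ f q₀)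
    (hP : (BinTree.postcriticalOrbit f {p₀, q₀}).Infinite) :
    ((BinTree.CaseA f p₀ q₀ ∨
        (∃ r s : ℕ, BinTree.CaseB f p₀ q₀ r s) ∨
        (∃ r s : ℕ, BinTree.CaseB f q₀ p₀ r s) ∨
        (∃ r s : ℕ, BinTree.CaseC f p₀ q₀ r s ∧ r ≠ s)) →
      ∀ G : Subgroup BinTree.W, BinTree.GroupWeaklyOfType f {p₀, q₀} G → G = ⊤) ∧
    (∀ G G' : Subgroup BinTree.W,
      BinTree.GroupStronglyOfType f {p₀, q₀} G → BinTree.GroupStronglyOfType f {p₀, q₀} G' →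
        ∃ w : BinTree.W, G' = G.map (MulAut.conj w).toMonoidHom) := by
  refine ⟨fun h G hG => BinTree.eq_top_of_cases h hG, fun G G' hG hG' => ?_⟩
  by_cases h : BinTree.CaseA f p₀ q₀ ∨ (∃ r s : ℕ, BinTree.CaseB f p₀ q₀ r s) ∨
      (∃ r s : ℕ, BinTree.CaseB f q₀ p₀ r s) ∨ (∃ r s : ℕ, BinTree.CaseC f p₀ q₀ r s ∧ r ≠ s)
  · refine ⟨1, ?_⟩
    rw [BinTree.eq_top_of_cases h hG.weakly, BinTree.eq_top_of_cases h hG'.weakly]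
    exact (Subgroup.map_top_of_surjective _ (MulAut.conj (1 : BinTree.W)).surjective).symm
  · obtain ⟨r, hr⟩ : ∃ r, BinTree.CaseC f p₀ q₀ r r := by
      rcases BinTree.cases_of_infinite hf hP with h' | h' | h' | ⟨r, s, h'⟩
      · exact absurd (Or.inl h') h
      · exact absurd (Or.inr (Or.inl h')) h
      · exact absurd (Or.inr (Or.inr (Or.inl h'))) h
      · by_cases hrs : r = s
        · subst hrs
          exact ⟨r, h'⟩
        · exact absurd (Or.inr (Or.inr (Or.inr ⟨r, s, h', hrs⟩))) h
    exact BinTree.exists_map_conj_eq_of_levelGroup (hr.exists_map_conj_eq_levelGroup hG)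
      (hr.exists_map_conj_eq_levelGroup hG')
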